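/- Write $[U]=\{1,\dots,U\}$. In the set intersection problem $\mathsf{SetInt}_{U,k,l}$ Alice gets a $k$-subset $X$ of $[U]$, Bob gets an $l$-subset $Y$ of $[U]$, and both players must learn $X\cap Y$. A Las Vegas Two-Phase protocol is a randomized communication protocol with a public coin and a private coin for each player (the three coins being independent), given by binary protocol trees selected by the public coin, such that: - on every input $(x,y)$ with $|x|=k$ and $|y|=l$, with probability one over the coins, the protocol halts and both players answer $x\cap y$; - on every root-to-leaf path exactly one node is marked as the phase-transition node. Bits sent before this node is reached belong to phase one, all later bits belong to phase two. Let $\mathcal U_{U,k,l}$ be the law of $(X,Y)$, where $X$ is a uniformly random $k$-subset and $Y$ an independent uniformly random $l$-subset of $[U]$. The cost $C(P,\mathcal U_{U,k,l})=(a_1,b_1,a_2,b_2)$ of a protocol $P$ consists of the expected numbers (over the inputs and the coins) of bits sent in phase one by Alice and by Bob, and in phase two by Alice and by Bob. Lemma. For $l\gg k$, $U\gg l$ and any $r>1$, no Las Vegas Two-Phase protocol $P$ for $\mathsf{SetInt}_{U,k,l}$ has $C(P,\mathcal U_{U,k,l})=(o(k),o(l),o(k\log r),o(k/r))$. That is,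 there are absolute constants $\varepsilon>0$ and $C$ such that for all integers $k\ge 1$, $l$ and $U$ with $k\le U$, $l\le U$, $l\ge Ck$ and $U\ge Cl$, for every real $r>1$, and for every Las Vegas Two-Phase protocol $P$ for $\mathsf{SetInt}_{U,k,l}$ with $C(P,\mathcal U_{U,k,l})=(a_1,b_1,a_2,b_2)$, the four inequalities \[ a_1\le \varepsilon k,\qquad b_1\le \varepsilon l,\qquad a_2\le \varepsilon k\log_2 r,\qquad b_2\le \varepsilon k/r \] do not all hold. -/

import Mathlib

open MeasureTheory
open scoped ENNReal

universe u

/-- The two players. -/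
inductive Player where
  | alice
  | bob

/-- The two phases of a Two-Phase protocol. -/
inductive Phase where
  | one
  | two

/-- A deterministic binary protocol tree, possibly infinite. Alice has an input in `α`, Bob has an
input in `β`, and both players give an answer in `γ`. A node is named by the bits written on the
path from the root to it. `node v = some p` means that player `p` sends the next bit at `v`, and
`node v = none` means that `v` is a leaf (what lies below a leaf is not part of the tree). At a leaf
each player answers as a function of the transcript and of the player's own input. -/
structure ProtocolTree (α β γ : Type*) where
  node : List Bool → Option Player
  bitA : List Bool → α → Bool
  bitB : List Bool → β → Bool
  outA : List Bool → α → γ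
  outB : List Bool → β → γ

namespace ProtocolTree

variable {α β γ : Type*}

/-- `v` is a leaf of the tree: it is labelled as a leaf and no proper ancestor is. -/
def IsLeaf (T : ProtocolTree α β γ) (v : List Bool) : Prop :=
  T.node v = none ∧ ∀ u, u <+: v → u ≠ v → T.node u ≠ none

/-- One round of communication from the transcript `v`. Nothing happens at a leaf. -/
def step (T : ProtocolTree α β γ) (x : α) (y : β) (v : List Bool) : List Bool :=
  match T.node v with
  | none => v
  | some Player.alice => v ++ [T.bitA v x]
  | some Player.bob => v ++ [T.bitB v y]

/-- The transcript after `n` rounds on the input `(x, y)`. -/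
def run (T : ProtocolTree α β γ) (x : α) (y : β) (n : ℕ) : List Bool :=
  (T.step x y)^[n] []

/-- On the input `(x, y)` the protocol reaches a leaf, and there both players answer `z`. -/
def BothOutput (T : ProtocolTree α β γ) (x : α) (y : β) (z : γ) : Prop :=
  ∃ n, T.node (T.run x y n) = none ∧
    T.outA (T.run x y n) x = z ∧ T.outB (T.run x y n) y = z

end ProtocolTree

/-- A protocol tree with marked phase-transition nodes, exactly one on every root-to-leaf path. -/
structure TwoPhaseTree (α β γ : Type*) extends ProtocolTree α β γ where
  marked : Set (List Bool)
  marked_unique : ∀ v, toProtocolTree.IsLeaf v → ∃! u, u <+: v ∧ u ∈ marked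

namespace TwoPhaseTree

variable {α β γ : Type*}

open Classical in
/-- The phase to which a bit sent at the node `v` belongs: phase two from the phase-transition
node on, phase one before it. -/
noncomputable def phase (T : TwoPhaseTree α β γ) (v : List Bool) : Phase :=
  if ∃ u, u <+: v ∧ u ∈ T.marked then Phase.two else Phase.one

open Classical in
/-- The number of bits (possibly `∞`) which player `p` sends in phase `i` on the input `(x, y)`. -/
noncomputable def bits (T : TwoPhaseTree α β γ) (p : Player) (i : Phase) (x : α) (y : β) : ℝ≥0∞ :=
  ∑' n : ℕ, if T.node (T.run x y n) = some p ∧ T.phase (T.run x y n) = i then 1 else 0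

end TwoPhaseTree

/-- A randomized Two-Phase protocol with public coins and with private coins for each player. The
three coins are independent, with arbitrary laws. The value of the public coin selects a
Two-Phase tree, in which Alice acts on her input and her private coin, and Bob on his input and his
private coin. -/
structure TwoPhaseProtocol (α β γ : Type*) where
  Pub : Type u
  CoinA : Type u
  CoinB : Type u
  [measPub : MeasurableSpace Pub]
  [measA : MeasurableSpace CoinA]
  [measB : MeasurableSpace CoinB]
  lawPub : Measure Pub
  lawA : Measure CoinA
  lawB : Measure CoinB
  [probPub : IsProbabilityMeasure lawPub]
  [probA : IsProbabilityMeasure lawA]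
  [probB : IsProbabilityMeasure lawB]
  tree : Pub → TwoPhaseTree (α × CoinA) (β × CoinB) γ
  measurableSet_node : ∀ v s, MeasurableSet {ω | (tree ω).node v = s}
  measurableSet_marked : ∀ v, MeasurableSet {ω | v ∈ (tree ω).marked}
  measurable_bitA : ∀ v x, Measurable fun ω : Pub × CoinA => (tree ω.1).bitA v (x, ω.2)
  measurable_bitB : ∀ v y, Measurable fun ω : Pub × CoinB => (tree ω.1).bitB v (y, ω.2)

namespace TwoPhaseProtocol

variable {α β γ : Type*}

attribute [instance] measPub measA measB probPub probA probB

/-- The joint law of the public coin and the two private coins. -/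
noncomputable def law (P : TwoPhaseProtocol.{u} α β γ) : Measure (P.Pub × P.CoinA × P.CoinB) :=
  P.lawPub.prod (P.lawA.prod P.lawB)

/-- On the input `(x, y)`, with probability one, the protocol halts and both players answer `z`. -/
def ZeroError (P : TwoPhaseProtocol.{u} α β γ) (x : α) (y : β) (z : γ) : Prop :=
  ∀ᵐ ω ∂P.law, (P.tree ω.1).BothOutput (x, ω.2.1) (y, ω.2.2) z

/-- The expected number of bits which player `p` sends in phase `i` on the input `(x, y)`. -/
noncomputable def costOn (P : TwoPhaseProtocol.{u} α β γ) (p : Player) (i : Phase)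
    (x : α) (y : β) : ℝ≥0∞ :=
  ∫⁻ ω, (P.tree ω.1).bits p i (x, ω.2.1) (y, ω.2.2) ∂P.law

/-- The expected number of bits which player `p` sends in phase `i` when the pair of inputs has
law `μ`. -/
noncomputable def cost (P : TwoPhaseProtocol.{u} α β γ) (μ : PMF (α × β))
    (p : Player) (i : Phase) : ℝ≥0∞ :=
  ∑' z : α × β, μ z * P.costOn p i z.1 z.2

end TwoPhaseProtocol

/-- `P` is a Las Vegas protocol for set intersection: for every `k`-subset `x` and `l`-subset `y`
of the universe `Fin U`, both players learn `x ∩ y` without error. -/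
def SolvesSetInt (U k l : ℕ)
    (P : TwoPhaseProtocol.{u} (Finset (Fin U)) (Finset (Fin U)) (Finset (Fin U))) : Prop :=
  ∀ x y : Finset (Fin U), x.card = k → y.card = l → P.ZeroError x y (x ∩ y)

/-- The law of two independent sets, a uniform `k`-subset and a uniform `l`-subset of `Fin U`. -/
noncomputable def unifSetInt (U k l : ℕ) (hk : k ≤ U) (hl : l ≤ U) :
    PMF (Finset (Fin U) × Finset (Fin U)) :=
  PMF.uniformOfFinset
    (Finset.powersetCard k (Finset.univ : Finset (Fin U)) ×ˢ
      Finset.powersetCard l (Finset.univ : Finset (Fin U)))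
    (Finset.Nonempty.product
      (Finset.powersetCard_nonempty.2 (by simpa using hk))
      (Finset.powersetCard_nonempty.2 (by simpa using hl)))

/-!
By Markov's inequality one may fix the coins, and one may order the elements of the input sets at
random, so that the inputs are random injective sequences. For a deterministic protocol the
transcripts after phase one and at the end have rectangles as level sets, so for fixed input of one
player the entropy of a transcript is at most `log 2` times the expected number of bits of the
other; the chain rule splits it into the information revealed about the single entries.

Consider Alice's `j`-th entry from the point of view of Bob's `i`-th. It lies in Bob's set with
probability at most `2 l / |α|`. It is rare as Bob's next entry, given phase one, with small
probability unless phase one is expensive. Otherwise the final transcript excludes it as an entry of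
Bob. A large set `E` of excluded elements which were not rare costs Bob information
`|E| / (4 |α|)` in phase two, while hitting a small one with constant probability costs Alice
information of order `log (1 + M)` by Gibbs' inequality, where `1 / M` bounds the size of `E`
relative to `α`. The choice `M = r` gives the stated tradeoff.
-/

namespace SetInt

open Finset
open scoped BigOperators

lemma sum_comp_div_card {ι κ : Type*} [DecidableEq κ] (A : Finset ι) (q : ι → κ) (f : κ → ℝ) :
    ∑ x ∈ A, f (q x) / #{x' ∈ A | q x' = q x} = ∑ v ∈ A.image q, f v := by
  rw [sum_comp (fun v => f v / #{x' ∈ A | q x' = v}) q]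
  refine sum_congr rfl fun v hv => ?_
  obtain ⟨x, hx, rfl⟩ := mem_image.1 hv
  have : (#{x' ∈ A | q x' = q x} : ℝ) ≠ 0 :=
    Nat.cast_ne_zero.2 (card_ne_zero_of_mem (mem_filter.2 ⟨hx, rfl⟩))
  rw [nsmul_eq_mul, mul_div_cancel₀ _ this]

section Fiber

variable {Ω V W : Type*} [Fintype Ω]

open Classical in
/-- The points of the finite probability space `Ω` at which the random variable `p` takes the same
value as at `x`. It stands for the event on which one conditions when `p` is observed at `x`. -/
noncomputable def fiber (p : Ω → V) (x : Ω) : Finset Ω := {x' | p x' = p x}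

variable {p : Ω → V} {q : Ω → W} {x x' : Ω}

@[simp]
lemma mem_fiber : x' ∈ fiber p x ↔ p x' = p x := by simp [fiber]

lemma self_mem_fiber (p : Ω → V) (x : Ω) : x ∈ fiber p x := mem_fiber.2 rfl

lemma fiber_nonempty (p : Ω → V) (x : Ω) : (fiber p x).Nonempty := ⟨x, self_mem_fiber p x⟩

lemma card_fiber_pos (p : Ω → V) (x : Ω) : (0 : ℝ) < #(fiber p x) :=
  Nat.cast_pos.2 (fiber_nonempty p x).card_pos

lemma fiber_eq_fiber (h : p x' = p x) : fiber p x' = fiber p x := by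
  ext; simp [h]

lemma fiber_subset_fiber (h : q.FactorsThrough p) (x : Ω) : fiber p x ⊆ fiber q x :=
  fun _ hx' => mem_fiber.2 (h (mem_fiber.1 hx'))

lemma fiber_prodMk [DecidableEq W] (p : Ω → V) (q : Ω → W) (x : Ω) :
    fiber (fun a => (p a, q a)) x = {x' ∈ fiber p x | q x' = q x} := by
  ext; simp

lemma expect_expect_fiber (p : Ω → V) (f : Ω → ℝ) :
    𝔼 x, 𝔼 x' ∈ fiber p x, f x' = 𝔼 x, f x := by
  classical
  simp only [Fintype.expect_eq_sum_div_card]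
  congr 1
  calc ∑ x, 𝔼 x' ∈ fiber p x, f x'
      = ∑ x, ∑ x' ∈ fiber p x, f x' / #(fiber p x') := by
        refine sum_congr rfl fun x _ => ?_
        rw [expect_eq_sum_div_card, sum_div]
        exact sum_congr rfl fun x' hx' => by rw [fiber_eq_fiber (mem_fiber.1 hx')]
    _ = ∑ x', ∑ _x ∈ fiber p x', f x' / #(fiber p x') :=
        sum_comm' fun x x' => by simp [eq_comm]
    _ = ∑ x', f x' := by
        refine sum_congr rfl fun x' _ => ?_
        rw [sum_const, nsmul_eq_mul, mul_div_cancel₀ _ (card_fiber_pos p x').ne']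

lemma sum_fiber_div_card_fiber_prodMk [DecidableEq W] (p : Ω → V) (q : Ω → W) (f : W → ℝ)
    (x : Ω) :
    ∑ x' ∈ fiber p x, f (q x') / #(fiber (fun a => (p a, q a)) x') =
      ∑ v ∈ (fiber p x).image q, f v := by
  rw [← sum_comp_div_card]
  refine sum_congr rfl fun x' hx' => ?_
  rw [fiber_prodMk, fiber_eq_fiber (mem_fiber.1 hx')]

end Fiber

section Entropy

variable {Ω V W β : Type*} [Fintype Ω]

/-- The Shannon entropy, in nats, of the random variable `p` on the uniform space `Ω`. -/
noncomputable def entropy (p : Ω → V) : ℝ := 𝔼 x, Real.log (Fintype.card Ω / #(fiber p x))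

lemma entropy_mono {p : Ω → V} {q : Ω → W} (h : q.FactorsThrough p) :
    entropy q ≤ entropy p := by
  refine expect_le_expect fun x _ => ?_
  have : 0 < (Fintype.card Ω : ℝ) := Nat.cast_pos.2 (Fintype.card_pos_iff.2 ⟨x⟩)
  have := card_fiber_pos p x
  have := card_fiber_pos q x
  gcongr
  exact fiber_subset_fiber h x

lemma entropy_congr {p : Ω → V} {q : Ω → W} (h : q.FactorsThrough p) (h' : p.FactorsThrough q) :
    entropy p = entropy q :=
  (entropy_mono h').antisymm (entropy_mono h)

lemma entropy_const (v : V) : entropy (fun _ : Ω => v) = 0 := by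
  refine expect_eq_zero fun x _ => ?_
  have : fiber (fun _ : Ω => v) x = univ := by ext; simp
  have h : (Fintype.card Ω : ℝ) ≠ 0 := Nat.cast_ne_zero.2 (Fintype.card_pos_iff.2 ⟨x⟩).ne'
  rw [this, card_univ, div_self h, Real.log_one]

lemma entropy_prodMk_le [DecidableEq W] (s : Ω → V) (q : Ω → W) :
    entropy (fun x => (s x, q x)) ≤ entropy s + 𝔼 x, Real.log #((fiber s x).image q) := by
  set t : Ω → V × W := fun x => (s x, q x) with ht
  let z (x : Ω) : ℝ := #(fiber s x) / (#((fiber s x).image q) * #(fiber t x))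
  have hm (x : Ω) : (0 : ℝ) < #((fiber s x).image q) :=
    Nat.cast_pos.2 ((fiber_nonempty s x).image q).card_pos
  have hz (x : Ω) : 0 < z x :=
    div_pos (card_fiber_pos s x) (mul_pos (hm x) (card_fiber_pos t x))
  have expect_z : 𝔼 x, z x = 𝔼 _x : Ω, 1 := by
    rw [← expect_expect_fiber s z]
    refine expect_congr rfl fun x _ => ?_
    calc 𝔼 x' ∈ fiber s x, z x'
        = (∑ x' ∈ fiber s x, (#((fiber s x).image q) : ℝ)⁻¹ / #(fiber t x')) := by
          rw [expect_eq_sum_div_card, sum_div]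
          refine sum_congr rfl fun x' hx' => ?_
          have := card_fiber_pos s x
          simp only [z, fiber_eq_fiber (mem_fiber.1 hx')]
          field_simp
      _ = 1 := by
          rw [sum_fiber_div_card_fiber_prodMk s q fun _ => (#((fiber s x).image q) : ℝ)⁻¹,
            sum_const, nsmul_eq_mul, mul_inv_cancel₀ (hm x).ne']
  have log_le (x : Ω) : Real.log (Fintype.card Ω / #(fiber t x)) ≤
      Real.log (Fintype.card Ω / #(fiber s x)) + Real.log #((fiber s x).image q) + (z x - 1) := by
    have hΩ : (Fintype.card Ω : ℝ) ≠ 0 := Nat.cast_ne_zero.2 (Fintype.card_pos_iff.2 ⟨x⟩).ne'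
    have h := Real.log_le_sub_one_of_pos (hz x)
    have := (card_fiber_pos s x).ne'
    have := (card_fiber_pos t x).ne'
    simp only [z] at h ⊢
    rw [Real.log_div (by assumption) (mul_ne_zero (hm x).ne' (by assumption)),
      Real.log_mul (hm x).ne' (by assumption)] at h
    rw [Real.log_div hΩ (by assumption), Real.log_div hΩ (by assumption)]
    linarith
  calc entropy t ≤ _ := expect_le_expect fun x _ => log_le x
    _ = _ := by rw [expect_add_distrib, expect_add_distrib, expect_sub_distrib, expect_z,
      sub_self, add_zero, entropy]

lemma entropy_le_add_of_bit {s : Ω → V} {p : Ω → W} {b : Ω → Bool} {Q : V → Prop}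
    [DecidablePred Q] (h : ∀ x x', s x = s x' → (Q (s x) → b x = b x') → p x = p x') :
    entropy p ≤ entropy s + Real.log 2 * 𝔼 x, (if Q (s x) then 1 else 0 : ℝ) := by
  let b' (x : Ω) : Bool := if Q (s x) then b x else false
  have determined : p.FactorsThrough fun x => (s x, b' x) := by
    intro x x' hxx'
    obtain ⟨hs, hb⟩ := Prod.ext_iff.1 hxx'
    refine h x x' hs fun hQ => ?_
    have hQ' : Q (s x') := by rwa [← show s x = s x' from hs]
    simpa only [b', if_pos hQ, if_pos hQ'] using hb
  have log_card_le (x : Ω) : Real.log #((fiber s x).image b') ≤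
      Real.log 2 * if Q (s x) then 1 else 0 := by
    have pos : (0 : ℝ) < #((fiber s x).image b') :=
      Nat.cast_pos.2 ((fiber_nonempty _ x).image b').card_pos
    split_ifs with hQ
    · rw [mul_one]
      exact Real.log_le_log pos (by exact_mod_cast card_le_univ ((fiber s x).image b'))
    · rw [mul_zero]
      refine Real.log_nonpos pos.le (Nat.cast_le_one.2 (card_le_one.2 ?_))
      simp only [mem_image, mem_fiber, b']
      rintro _ ⟨x₁, h₁, rfl⟩ _ ⟨x₂, h₂, rfl⟩
      rw [h₁, h₂, if_neg hQ, if_neg hQ]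
  refine (entropy_mono determined).trans ((entropy_prodMk_le s b').trans ?_)
  rw [mul_expect]
  gcongr
  exact log_card_le _

lemma entropy_process_le {R : ℕ → Ω → V} {b : ℕ → Ω → Bool} {Q : V → Prop} [DecidablePred Q]
    {N : ℕ} (h : ∀ n < N, ∀ x x', R n x = R n x' → (Q (R n x) → b n x = b n x') →
      R (n + 1) x = R (n + 1) x') :
    entropy (R N) ≤ entropy (R 0) + Real.log 2 * 𝔼 x, (#{n ∈ range N | Q (R n x)} : ℝ) := by
  induction N with
  | zero => simp
  | succ n ih =>
    specialize ih fun m hm => h m (hm.trans n.lt_succ_self)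
    have step := entropy_le_add_of_bit (h n n.lt_succ_self)
    have count (x : Ω) : (#{m ∈ range (n + 1) | Q (R m x)} : ℝ) =
        #{m ∈ range n | Q (R m x)} + if Q (R n x) then 1 else 0 := by
      rw [range_add_one, filter_insert]
      split_ifs <;> simp
    simp only [count, expect_add_distrib]
    linarith

/-- The mutual information `I(ξ ; g | s)`, in nats, on the uniform space `Ω`. -/
noncomputable def condMutualInfo (ξ : Ω → β) (g : Ω → W) (s : Ω → V) : ℝ :=
  entropy (fun x => (s x, ξ x)) + entropy (fun x => (s x, g x)) - entropy s -
    entropy (fun x => (s x, ξ x, g x))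

section ChainRule

variable {k : ℕ}

/-- The restriction of a sequence of length `k` to the indices below `n`. -/
def initial (n : ℕ) (a : Fin k → β) : {t : Fin k // (t : ℕ) < n} → β := fun t => a t

lemma initial_eq_iff {n : ℕ} {a b : Fin k → β} :
    initial n a = initial n b ↔ ∀ t : Fin k, (t : ℕ) < n → a t = b t := by
  simp [initial, funext_iff]

lemma initial_succ_eq_iff {i : Fin k} {a b : Fin k → β} :
    initial (i + 1) a = initial (i + 1) b ↔ initial i a = initial i b ∧ a i = b i := by
  simp only [initial_eq_iff, Nat.lt_succ_iff_lt_or_eq, ← Fin.ext_iff]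
  constructor
  · exact fun h => ⟨fun t ht => h t (Or.inl ht), h i (Or.inr rfl)⟩
  · rintro ⟨h, hi⟩ t (ht | rfl)
    exacts [h t ht, hi]

lemma initial_eq_iff_eq {a b : Fin k → β} : initial k a = initial k b ↔ a = b := by
  rw [initial_eq_iff, funext_iff]
  simp

lemma sum_condMutualInfo_initial (ξ : Ω → Fin k → β) (g : Ω → W) (s : Ω → V) :
    ∑ i, condMutualInfo (fun x => ξ x i) g (fun x => (initial i (ξ x), s x)) =
      condMutualInfo ξ g s := by
  let F (n : ℕ) : ℝ := entropy (fun x => (initial n (ξ x), s x)) -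
    entropy (fun x => ((initial n (ξ x), s x), g x))
  have summand (i : Fin k) :
      condMutualInfo (fun x => ξ x i) g (fun x => (initial i (ξ x), s x)) =
        F (i + 1) - F i := by
    have h₁ : entropy (fun x => ((initial i (ξ x), s x), ξ x i)) =
        entropy (fun x => (initial (i + 1) (ξ x), s x)) := by
      apply entropy_congr <;> intro x x' <;> simp [initial_succ_eq_iff] <;> tauto
    have h₂ : entropy (fun x => ((initial i (ξ x), s x), ξ x i, g x)) =
        entropy (fun x => ((initial (i + 1) (ξ x), s x), g x)) := by
      apply entropy_congr <;> intro x x' <;> simp [initial_succ_eq_iff] <;> tauto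
    simp only [condMutualInfo, F, h₁, h₂]
    ring
  have last : F k = entropy (fun x => (s x, ξ x)) - entropy (fun x => (s x, ξ x, g x)) := by
    simp only [F]
    congr 1 <;> apply entropy_congr <;> intro x x' <;> simp [initial_eq_iff_eq] <;> tauto
  have first : F 0 = entropy s - entropy (fun x => (s x, g x)) := by
    simp only [F]
    congr 1 <;> apply entropy_congr <;> intro x x' <;> simp [initial_eq_iff]
  rw [sum_congr rfl fun i _ => summand i,
    Fin.sum_univ_eq_sum_range (fun n => F (n + 1) - F n), sum_range_sub, last, first]
  simp only [condMutualInfo]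
  ring

lemma sum_condMutualInfo_initial_of_injective {ξ : Ω → Fin k → β} (hξ : ξ.Injective) (g : Ω → W)
    (s : Ω → V) :
    ∑ i, condMutualInfo (fun x => ξ x i) g (fun x => (initial i (ξ x), s x)) =
      entropy (fun x => (s x, g x)) - entropy s := by
  have : entropy (fun x => (s x, ξ x, g x)) = entropy (fun x => (s x, ξ x)) := by
    apply entropy_congr <;> intro x x' <;> simp +contextual [hξ.eq_iff]
  rw [sum_condMutualInfo_initial, condMutualInfo, this]
  ring

lemma sum_condMutualInfo_initial_eq_entropy {ξ : Ω → Fin k → β} (hξ : ξ.Injective) (g : Ω → W) :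
    ∑ i, condMutualInfo (fun x => ξ x i) g (fun x => initial i (ξ x)) = entropy g := by
  have drop_unit (i : Fin k) : condMutualInfo (fun x => ξ x i) g (fun x => initial i (ξ x)) =
      condMutualInfo (fun x => ξ x i) g (fun x => (initial i (ξ x), ())) := by
    simp only [condMutualInfo]
    congr 1
    · congr 1
      · congr 1 <;> apply entropy_congr <;> intro x x' <;> simp
      · apply entropy_congr <;> intro x x' <;> simp
    · apply entropy_congr <;> intro x x' <;> simp
  have h : entropy (fun x => ((), g x)) = entropy g := by
    apply entropy_congr <;> intro x x' <;> simp
  rw [sum_congr rfl fun i _ => drop_unit i, sum_condMutualInfo_initial_of_injective hξ,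
    entropy_const, h, sub_zero]

end ChainRule

end Entropy

section CondProb

variable {Ω V W β : Type*} [Fintype Ω]

open Classical in
/-- The conditional probability `P(ξ ∈ E | s)`, evaluated at the point `x` of the uniform space
`Ω`. -/
noncomputable def condProb (s : Ω → V) (ξ : Ω → β) (E : Finset β) (x : Ω) : ℝ :=
  𝔼 x' ∈ fiber s x, if ξ x' ∈ E then 1 else 0

open Classical in
/-- The probability of the event `A` in the uniform space `Ω`. -/
noncomputable def prob (A : Ω → Prop) : ℝ := 𝔼 x, if A x then 1 else 0

lemma prob_nonneg (A : Ω → Prop) : 0 ≤ prob A :=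
  expect_nonneg fun _ _ => by split_ifs <;> norm_num

lemma one_le_prob_add_prob_add_prob [Nonempty Ω] {A B C : Ω → Prop}
    (h : ∀ x, A x ∨ B x ∨ C x) : 1 ≤ prob A + prob B + prob C := by
  simp only [prob, ← expect_add_distrib]
  rw [← Fintype.expect_const (ι := Ω) (1 : ℝ)]
  refine expect_le_expect fun x _ => ?_
  have := h x
  split_ifs <;> first | tauto | norm_num

lemma condProb_nonneg (s : Ω → V) (ξ : Ω → β) (E : Finset β) (x : Ω) : 0 ≤ condProb s ξ E x :=
  expect_nonneg fun _ _ => by split_ifs <;> norm_num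

lemma condProb_univ [Fintype β] (s : Ω → V) (ξ : Ω → β) (x : Ω) : condProb s ξ univ x = 1 := by
  simp [condProb, expect_const (fiber_nonempty s x)]

lemma condProb_congr {s : Ω → V} {x x' : Ω} (h : s x' = s x) (ξ : Ω → β) (E : Finset β) :
    condProb s ξ E x' = condProb s ξ E x := by
  rw [condProb, condProb, fiber_eq_fiber h]

lemma condProb_eq_sum (s : Ω → V) (ξ : Ω → β) (E : Finset β) (x : Ω) :
    condProb s ξ E x = ∑ e ∈ E, condProb s ξ {e} x := by
  classical
  simp only [condProb, mem_singleton]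
  rw [← expect_sum_comm]
  exact expect_congr rfl fun x' _ => by rw [sum_ite_eq]

lemma expect_condProb {s : Ω → V} {E : Ω → Finset β} (hE : E.FactorsThrough s) (ξ : Ω → β) :
    𝔼 x, condProb s ξ (E x) x = prob fun x => ξ x ∈ E x := by
  rw [prob]
  refine Eq.trans ?_ (expect_expect_fiber s _)
  refine expect_congr rfl fun x _ => expect_congr rfl fun x' hx' => ?_
  congr 1
  rw [hE (mem_fiber.1 hx')]

lemma sum_fiber_mul_div_card_le {s : Ω → V} {g : Ω → W} {ξ : Ω → β} {f : β → ℝ}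
    (hf : ∀ b, 0 ≤ f b) (x : Ω) :
    ∑ x' ∈ fiber (fun a => (s a, g a)) x,
        f (ξ x') * #(fiber (fun a => (s a, ξ a)) x') / #(fiber (fun a => (s a, ξ a, g a)) x') ≤
      ∑ x' ∈ fiber s x, f (ξ x') := by
  classical
  let c (v : β) : ℝ := #{x' ∈ fiber s x | ξ x' = v}
  have hsub : fiber (fun a => (s a, g a)) x ⊆ fiber s x :=
    fiber_subset_fiber (fun _ _ h => (Prod.ext_iff.1 h).1) x
  have term {x' : Ω} (hx' : x' ∈ fiber (fun a => (s a, g a)) x) :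
      f (ξ x') * #(fiber (fun a => (s a, ξ a)) x') / #(fiber (fun a => (s a, ξ a, g a)) x') =
        f (ξ x') * c (ξ x') / #(fiber (fun a => ((s a, g a), ξ a)) x') := by
    have hξ : fiber (fun a => (s a, ξ a)) x' = {a ∈ fiber s x | ξ a = ξ x'} := by
      rw [fiber_prodMk, fiber_eq_fiber (mem_fiber.1 (hsub hx'))]
    have hξg : fiber (fun a => (s a, ξ a, g a)) x' = fiber (fun a => ((s a, g a), ξ a)) x' := by
      ext
      simp only [mem_fiber, Prod.mk.injEq]
      tauto
    rw [hξ, hξg]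
  calc _ = ∑ x' ∈ fiber (fun a => (s a, g a)) x,
          f (ξ x') * c (ξ x') / #(fiber (fun a => ((s a, g a), ξ a)) x') :=
        sum_congr rfl fun x' => term
    _ = ∑ v ∈ (fiber (fun a => (s a, g a)) x).image ξ, f v * c v :=
        sum_fiber_div_card_fiber_prodMk _ ξ (fun v => f v * c v) x
    _ ≤ ∑ v ∈ (fiber s x).image ξ, f v * c v :=
        sum_le_sum_of_subset_of_nonneg (image_subset_image hsub)
          fun v _ _ => mul_nonneg (hf v) (Nat.cast_nonneg _)
    _ = ∑ x' ∈ fiber s x, f (ξ x') := by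
        rw [sum_comp f ξ]
        exact sum_congr rfl fun v _ => by rw [nsmul_eq_mul, mul_comm]

/-- The likelihood ratio `P(ξ = v | s) / P(ξ = v | s, g)` at the observed value `v = ξ x`. -/
noncomputable def likelihoodRatio (ξ : Ω → β) (g : Ω → W) (s : Ω → V) (x : Ω) : ℝ :=
  #(fiber (fun a => (s a, ξ a)) x) * #(fiber (fun a => (s a, g a)) x) /
    (#(fiber s x) * #(fiber (fun a => (s a, ξ a, g a)) x))

lemma likelihoodRatio_pos (ξ : Ω → β) (g : Ω → W) (s : Ω → V) (x : Ω) :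
    0 < likelihoodRatio ξ g s x :=
  div_pos (mul_pos (card_fiber_pos _ x) (card_fiber_pos _ x))
    (mul_pos (card_fiber_pos s x) (card_fiber_pos _ x))

lemma condMutualInfo_eq_neg_expect_log (ξ : Ω → β) (g : Ω → W) (s : Ω → V) :
    condMutualInfo ξ g s = -𝔼 x, Real.log (likelihoodRatio ξ g s x) := by
  simp only [condMutualInfo, entropy, ← expect_add_distrib, ← expect_sub_distrib,
    ← expect_neg_distrib]
  refine expect_congr rfl fun x _ => ?_
  have hΩ : (Fintype.card Ω : ℝ) ≠ 0 := Nat.cast_ne_zero.2 (Fintype.card_pos_iff.2 ⟨x⟩).ne'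
  have hS := (card_fiber_pos s x).ne'
  have hSξ := (card_fiber_pos (fun a => (s a, ξ a)) x).ne'
  have hSg := (card_fiber_pos (fun a => (s a, g a)) x).ne'
  have hSξg := (card_fiber_pos (fun a => (s a, ξ a, g a)) x).ne'
  rw [likelihoodRatio, Real.log_div hΩ hSξ, Real.log_div hΩ hSg, Real.log_div hΩ hS,
    Real.log_div hΩ hSξg, Real.log_div (mul_ne_zero hSξ hSg) (mul_ne_zero hS hSξg),
    Real.log_mul hSξ hSg, Real.log_mul hS hSξg]
  ring

lemma expect_mul_likelihoodRatio_le {s : Ω → V} {g : Ω → W} {ξ : Ω → β} {F : Ω → β → ℝ}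
    (hF : F.FactorsThrough fun x => (s x, g x)) (nonneg : ∀ x b, 0 ≤ F x b) :
    𝔼 x, F x (ξ x) * likelihoodRatio ξ g s x ≤ 𝔼 x, 𝔼 x' ∈ fiber s x, F x (ξ x') := by
  let sg (x : Ω) : V × W := (s x, g x)
  rw [← expect_expect_fiber sg fun x => F x (ξ x) * likelihoodRatio ξ g s x]
  refine expect_le_expect fun x _ => ?_
  calc 𝔼 x' ∈ fiber sg x, F x' (ξ x') * likelihoodRatio ξ g s x'
      = (∑ x' ∈ fiber sg x, F x (ξ x') * #(fiber (fun a => (s a, ξ a)) x') /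
          #(fiber (fun a => (s a, ξ a, g a)) x')) / #(fiber s x) := by
        rw [expect_eq_sum_div_card, sum_div, sum_div]
        refine sum_congr rfl fun x' hx' => ?_
        have hsg : sg x' = sg x := mem_fiber.1 hx'
        have hs : s x' = s x := (Prod.ext_iff.1 hsg).1
        have := (card_fiber_pos s x).ne'
        have := (card_fiber_pos sg x).ne'
        rw [likelihoodRatio, ← fiber_eq_fiber hs, ← fiber_eq_fiber hsg, hF hsg] at *
        field_simp
        rfl
    _ ≤ (∑ x' ∈ fiber s x, F x (ξ x')) / #(fiber s x) :=
        div_le_div_of_nonneg_right (sum_fiber_mul_div_card_le (nonneg x) x) (Nat.cast_nonneg _)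
    _ = 𝔼 x' ∈ fiber s x, F x (ξ x') := (expect_eq_sum_div_card _ _).symm

/-- The Donsker–Varadhan inequality, with the logarithm of the exponential moment replaced by its
linear upper bound. -/
lemma expect_log_le_condMutualInfo {s : Ω → V} {g : Ω → W} {ξ : Ω → β} {F : Ω → β → ℝ}
    (hF : F.FactorsThrough fun x => (s x, g x)) (nonneg : ∀ x b, 0 ≤ F x b)
    (pos : ∀ x, 0 < F x (ξ x)) :
    𝔼 x, (Real.log (F x (ξ x)) + 1 - 𝔼 x' ∈ fiber s x, F x (ξ x')) ≤ condMutualInfo ξ g s := by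
  have log_le (x : Ω) : Real.log (F x (ξ x)) + Real.log (likelihoodRatio ξ g s x) ≤
      F x (ξ x) * likelihoodRatio ξ g s x - 1 := by
    have ratio_pos := likelihoodRatio_pos ξ g s x
    rw [← Real.log_mul (pos x).ne' ratio_pos.ne']
    exact Real.log_le_sub_one_of_pos (mul_pos (pos x) ratio_pos)
  have average := expect_le_expect fun x (_ : x ∈ univ) => log_le x
  have change_of_measure := expect_mul_likelihoodRatio_le (ξ := ξ) hF nonneg
  rw [condMutualInfo_eq_neg_expect_log]
  simp only [expect_add_distrib, expect_sub_distrib] at average ⊢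
  linarith

/-- For `c = -1` the conclusion is only meaningful because the junk value `Real.log 0 = 0` meets an
event of probability zero. -/
lemma log_mul_prob_sub_le_condMutualInfo {s : Ω → V} {g : Ω → W} {ξ : Ω → β}
    {E : Ω → Finset β} (hE : E.FactorsThrough fun x => (s x, g x)) {c : ℝ} (hc : -1 ≤ c)
    (h : c = -1 → ∀ x, ξ x ∉ E x) :
    Real.log (1 + c) * prob (fun x => ξ x ∈ E x) - c * 𝔼 x, condProb s ξ (E x) x ≤
      condMutualInfo ξ g s := by
  classical
  let F (x : Ω) (b : β) : ℝ := 1 + c * if b ∈ E x then 1 else 0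
  have hF : F.FactorsThrough fun x => (s x, g x) := fun x x' hx => by simp only [F, hE hx]
  have nonneg (x : Ω) (b : β) : 0 ≤ F x b := by
    simp only [F]; split_ifs <;> linarith
  have pos (x : Ω) : 0 < F x (ξ x) := by
    simp only [F]
    split_ifs with hx
    · have : -1 < c := lt_of_le_of_ne hc fun hc' => h hc'.symm x hx
      linarith
    · norm_num
  refine le_trans (le_of_eq ?_) (expect_log_le_condMutualInfo hF nonneg pos)
  rw [prob, mul_expect, mul_expect, ← expect_sub_distrib]
  refine expect_congr rfl fun x _ => ?_
  have mean : 𝔼 x' ∈ fiber s x, F x (ξ x') = 1 + c * condProb s ξ (E x) x := by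
    simp only [F]
    rw [expect_add_distrib, expect_const (fiber_nonempty s x), ← mul_expect, condProb]
  have log_eq : Real.log (F x (ξ x)) = Real.log (1 + c) * if ξ x ∈ E x then 1 else 0 := by
    simp only [F]; split_ifs <;> simp
  rw [mean, log_eq]
  split_ifs <;> ring

section Rare

variable [Fintype β]

open Classical in
/-- The values of `ξ` whose conditional probability given `s` drops to a quarter or less when `g` is
observed as well. -/
noncomputable def rare (ξ : Ω → β) (g : Ω → W) (s : Ω → V) (x : Ω) : Finset β :=
  {e | condProb (fun a => (s a, g a)) ξ {e} x ≤ condProb s ξ {e} x / 4}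

variable {ξ : Ω → β} {g : Ω → W} {s : Ω → V}

lemma mem_rare {e : β} {x : Ω} :
    e ∈ rare ξ g s x ↔ condProb (fun a => (s a, g a)) ξ {e} x ≤ condProb s ξ {e} x / 4 := by
  simp [rare]

lemma rare_factorsThrough : (rare ξ g s).FactorsThrough fun x => (s x, g x) := by
  intro x x' h
  have hs : s x = s x' := (Prod.ext_iff.1 h).1
  have hsg (e : β) : condProb (fun a => (s a, g a)) ξ {e} x =
      condProb (fun a => (s a, g a)) ξ {e} x' := condProb_congr h ξ {e}
  ext e
  rw [mem_rare, mem_rare, hsg, condProb_congr hs]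

lemma expect_condProb_rare_le :
    3 / 10 * 𝔼 x, condProb s ξ (rare ξ g s x) x ≤ condMutualInfo ξ g s := by
  have rare_le : prob (fun x => ξ x ∈ rare ξ g s x) ≤
      (𝔼 x, condProb s ξ (rare ξ g s x) x) / 4 := by
    rw [← expect_condProb rare_factorsThrough, expect_div]
    refine expect_le_expect fun x _ => ?_
    rw [condProb_eq_sum, condProb_eq_sum s, sum_div]
    exact sum_le_sum fun e he => mem_rare.1 he
  have gibbs := log_mul_prob_sub_le_condMutualInfo
    (rare_factorsThrough (ξ := ξ) (g := g) (s := s)) (c := -1 / 2) (by norm_num)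
    (ξ := ξ) (fun h => by norm_num at h)
  have log_half : Real.log (1 + -1 / 2) = -Real.log 2 := by rw [← Real.log_inv]; norm_num
  have nonneg := prob_nonneg fun x => ξ x ∈ rare ξ g s x
  rw [log_half] at gibbs
  nlinarith [Real.log_two_lt_d9, Real.log_two_gt_d9]

lemma condProb_div_four_le_of_disjoint_rare {E : Finset β} {x : Ω}
    (h : Disjoint E (rare ξ g s x)) :
    condProb s ξ E x / 4 ≤ condProb (fun a => (s a, g a)) ξ E x := by
  rw [condProb_eq_sum, condProb_eq_sum (fun a => (s a, g a)), sum_div]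
  exact sum_le_sum fun e he => le_of_not_ge fun hle => disjoint_left.1 h he (mem_rare.2 hle)

end Rare

end CondProb

section RandomEmbedding

variable {α : Type*} {k : ℕ}

/-- The entries of a random injective sequence that precede the entry at `i`. -/
abbrev before (i : Fin k) (x : Fin k ↪ α) : {t : Fin k // (t : ℕ) < i} → α := initial i x

/-- The entry at `i` of a random injective sequence, as a random variable. -/
abbrev entry (i : Fin k) (x : Fin k ↪ α) : α := x i

variable [Fintype α]

lemma val_lt_card (x : Fin k ↪ α) (i : Fin k) : (i : ℝ) < Fintype.card α := by
  have := Fintype.card_le_of_embedding x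
  rw [Fintype.card_fin] at this
  exact_mod_cast i.2.trans_le this

lemma mem_fiber_before {x x' : Fin k ↪ α} {i : Fin k} :
    x' ∈ fiber (before i) x ↔ ∀ t < i, x' t = x t := by
  rw [mem_fiber, initial_eq_iff]
  rfl

variable {V W : Type*}

lemma condProb_singleton_of_mem {p : (Fin k ↪ α) → V} {x : Fin k ↪ α} {i : Fin k} {e : α}
    (hp : (before i).FactorsThrough p) (he : e ∈ (Iio i).map x) :
    condProb p (entry i) {e} x = 0 := by
  obtain ⟨t, ht, rfl⟩ := mem_map.1 he
  refine expect_eq_zero fun x' hx' => if_neg fun h => ?_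
  have : x' t = x t :=
    mem_fiber_before.1 (fiber_subset_fiber hp x hx') t (mem_Iio.1 ht)
  exact (mem_Iio.1 ht).ne (x'.injective (this.trans (mem_singleton.1 h).symm))

lemma map_Iio_subset_rare (i : Fin k) (g : (Fin k ↪ α) → W) (x : Fin k ↪ α) :
    (Iio i).map x ⊆ rare (entry i) g (before i) x := by
  intro e he
  rw [mem_rare, condProb_singleton_of_mem (fun _ _ h => (Prod.ext_iff.1 h).1) he]
  exact div_nonneg (condProb_nonneg _ _ _ x) (by norm_num)

lemma condProb_entry_eq_of_notMem {x : Fin k ↪ α} {i : Fin k} {e e' : α}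
    (he : e ∉ (Iio i).map x) (he' : e' ∉ (Iio i).map x) :
    condProb (before i) (entry i) {e} x = condProb (before i) (entry i) {e'} x := by
  classical
  have swap_fixes (t : Fin k) (ht : t < i) : Equiv.swap e e' (x t) = x t :=
    Equiv.swap_apply_of_ne_of_ne (fun h => he (h ▸ mem_map_of_mem x (mem_Iio.2 ht)))
      (fun h => he' (h ▸ mem_map_of_mem x (mem_Iio.2 ht)))
  refine expect_equiv (Equiv.embeddingCongr (Equiv.refl _) (Equiv.swap e e')) (fun x' => ?_)
    (fun x' _ => ?_)
  · simp only [mem_fiber_before, Equiv.embeddingCongr]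
    refine forall₂_congr fun t ht => ?_
    conv_rhs => rw [← swap_fixes t ht]
    simp
  · simp [entry, Equiv.embeddingCongr, Equiv.swap_apply_eq_iff]

lemma condProb_entry_singleton {x : Fin k ↪ α} {i : Fin k} {e : α}
    (he : e ∉ (Iio i).map x) :
    condProb (before i) (entry i) {e} x = 1 / (Fintype.card α - i) := by
  classical
  have total : (#((Iio i).map x)ᶜ : ℝ) * condProb (before i) (entry i) {e} x = 1 := by
    have one : condProb (before i) (entry i) univ x = 1 := condProb_univ _ _ x
    rw [← one, condProb_eq_sum (E := univ), ← sum_compl_add_sum ((Iio i).map x),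
      sum_eq_zero fun e' => condProb_singleton_of_mem fun _ _ h => h, add_zero,
      sum_congr rfl fun e' he' => condProb_entry_eq_of_notMem (mem_compl.1 he') he, sum_const,
      nsmul_eq_mul]
  have card_unused : (#((Iio i).map x)ᶜ : ℝ) = Fintype.card α - i := by
    rw [card_compl, Nat.cast_sub (card_le_univ _), card_map, Fin.card_Iio]
  rw [← card_unused, eq_div_iff (left_ne_zero_of_mul_eq_one total), mul_comm, total]

lemma condProb_entry [DecidableEq α] (E : Finset α) (x : Fin k ↪ α) (i : Fin k) :
    condProb (before i) (entry i) E x = #(E \ (Iio i).map x) / (Fintype.card α - i) := by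
  rw [condProb_eq_sum, ← sum_sdiff (inter_subset_left (s₂ := (Iio i).map x)), sdiff_inter_self_left,
    sum_congr rfl fun e he => condProb_entry_singleton (mem_sdiff.1 he).2,
    sum_eq_zero fun e he => condProb_singleton_of_mem (fun _ _ h => h) (mem_inter.1 he).2,
    sum_const, nsmul_eq_mul]
  ring

lemma condProb_entry_le (hk : 2 * k ≤ Fintype.card α) (E : Finset α) (x : Fin k ↪ α)
    (i : Fin k) :
    condProb (before i) (entry i) E x ≤ 2 * #E / Fintype.card α := by
  classical
  have hi : (2 * i : ℝ) ≤ Fintype.card α := by exact_mod_cast by have := i.2; omega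
  have hcard : (#(E \ (Iio i).map x) : ℝ) ≤ #E := by exact_mod_cast card_le_card sdiff_subset
  have := val_lt_card x i
  rw [condProb_entry,
    div_le_div_iff₀ (by linarith) (by linarith [(Nat.cast_nonneg i : (0 : ℝ) ≤ i)])]
  nlinarith [(Nat.cast_nonneg #E : (0 : ℝ) ≤ #E)]

lemma card_sub_div_le_condProb_entry (E : Finset α) (x : Fin k ↪ α) (i : Fin k) :
    (#E - k : ℝ) / Fintype.card α ≤ condProb (before i) (entry i) E x := by
  classical
  have hi : (i : ℝ) < k := Nat.cast_lt.2 i.2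
  have hcard : (#E - k : ℝ) ≤ #(E \ (Iio i).map x) := by
    have := le_card_sdiff ((Iio i).map x) E
    rw [card_map, Fin.card_Iio, tsub_le_iff_right] at this
    have : (#E : ℝ) ≤ #(E \ (Iio i).map x) + i := by exact_mod_cast this
    linarith
  have hα := val_lt_card x i
  rw [condProb_entry]
  calc (#E - k : ℝ) / Fintype.card α ≤ #(E \ (Iio i).map x) / Fintype.card α := by gcongr
    _ ≤ _ := by
      gcongr
      linarith [(Nat.cast_nonneg i : (0 : ℝ) ≤ i)]

lemma card_div_le_condProb_entry {E : Finset α} {x : Fin k ↪ α} {i : Fin k}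
    (h : Disjoint E ((Iio i).map x)) :
    (#E : ℝ) / Fintype.card α ≤ condProb (before i) (entry i) E x := by
  classical
  have := val_lt_card x i
  rw [condProb_entry, sdiff_eq_self_of_disjoint h]
  gcongr
  linarith [(Nat.cast_nonneg i : (0 : ℝ) ≤ i)]

lemma prob_entry_mem_le (hk : 2 * k ≤ Fintype.card α) (E : Finset α) (i : Fin k) :
    prob (fun x : Fin k ↪ α => x i ∈ E) ≤ 2 * #E / Fintype.card α := by
  have : Nonempty (Fin k ↪ α) := Function.Embedding.nonempty_of_card_le (by simp; omega)
  have constant : (fun _ : Fin k ↪ α => E).FactorsThrough (before i) := fun _ _ _ => rfl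
  rw [← expect_condProb constant (entry i)]
  exact expect_le univ_nonempty fun x _ => condProb_entry_le hk E x i

lemma log_mul_prob_entry_mem_le (hk : 2 * k ≤ Fintype.card α) {i : Fin k} {g : (Fin k ↪ α) → W}
    {E : (Fin k ↪ α) → Finset α} (hE : E.FactorsThrough fun x => (before i x, g x)) {c : ℝ}
    (hc : 0 ≤ c) :
    Real.log (1 + c) * prob (fun x => x i ∈ E x) ≤
      condMutualInfo (entry i) g (before i) + 2 * c * 𝔼 x, (#(E x) / Fintype.card α : ℝ) := by
  have gibbs := log_mul_prob_sub_le_condMutualInfo (ξ := entry i) hE (by linarith : -1 ≤ c)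
    (by intro; linarith)
  have condProb_le : 𝔼 x, condProb (before i) (entry i) (E x) x ≤
      2 * 𝔼 x, (#(E x) / Fintype.card α : ℝ) := by
    rw [mul_expect]
    refine expect_le_expect fun x _ => (condProb_entry_le hk (E x) x i).trans_eq ?_
    ring
  nlinarith

lemma expect_card_rare_div_le [Nonempty (Fin k ↪ α)] (i : Fin k) (g : (Fin k ↪ α) → W) :
    𝔼 x, (#(rare (entry i) g (before i) x) / Fintype.card α : ℝ) ≤
      k / Fintype.card α + 10 / 3 * condMutualInfo (entry i) g (before i) := by
  have condProb_ge : 𝔼 x, (#(rare (entry i) g (before i) x) / Fintype.card α : ℝ) -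
      k / Fintype.card α ≤
        𝔼 x, condProb (before i) (entry i) (rare (entry i) g (before i) x) x := by
    rw [← Fintype.expect_const (ι := Fin k ↪ α) (k / Fintype.card α : ℝ), ← expect_sub_distrib]
    refine expect_le_expect fun x _ => ?_
    rw [← sub_div]
    exact card_sub_div_le_condProb_entry _ x i
  linarith [expect_condProb_rare_le (ξ := entry i) (g := g) (s := before i)]

lemma expect_card_div_le {i : Fin k} {u : (Fin k ↪ α) → V} {w : (Fin k ↪ α) → W}
    {E : (Fin k ↪ α) → Finset α} (hE : E.FactorsThrough fun x => ((before i x, u x), w x))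
    (never : ∀ x, x i ∉ E x) (plausible : ∀ x, Disjoint (E x) (rare (entry i) u (before i) x)) :
    𝔼 x, (#(E x) / Fintype.card α : ℝ) ≤
      4 * condMutualInfo (entry i) w (fun x => (before i x, u x)) := by
  have gibbs := log_mul_prob_sub_le_condMutualInfo (ξ := entry i) hE le_rfl fun _ => never
  have card_le : 𝔼 x, (#(E x) / Fintype.card α : ℝ) ≤
      4 * 𝔼 x, condProb (fun x => (before i x, u x)) (entry i) (E x) x := by
    rw [mul_expect]
    refine expect_le_expect fun x _ => ?_
    have := condProb_div_four_le_of_disjoint_rare (plausible x)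
    have := card_div_le_condProb_entry
      ((plausible x).mono_right (map_Iio_subset_rare i u x))
    linarith
  rw [add_neg_cancel, Real.log_zero] at gibbs
  linarith

end RandomEmbedding

section Rectangles

variable {X Y V W : Type*} {u : X → Y → V} {w : X → Y → W}

/-- The level sets of `u` are combinatorial rectangles. This is the property of the transcripts of
deterministic protocols on which the argument rests. -/
def IsRect (u : X → Y → V) : Prop :=
  ∀ ⦃x y x' y'⦄, u x y = u x' y' → u x y' = u x y

lemma IsRect.flip (hu : IsRect u) : IsRect (flip u) :=
  fun _ _ _ _ h => (hu h.symm).trans h.symm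

lemma IsRect.apply_eq_apply_iff (hu : IsRect u) {x x' : X} {y : Y} (h : u x y = u x' y) (y' : Y) :
    u x y' = u x y ↔ u x' y' = u x' y :=
  ⟨fun h' => hu (h.symm.trans h'.symm), fun h' => hu (h.trans h'.symm)⟩

lemma IsRect.prodMk (hu : IsRect u) (hw : IsRect w) : IsRect fun x y => (u x y, w x y) :=
  fun _ _ _ _ h => Prod.ext (hu (Prod.ext_iff.1 h).1) (hw (Prod.ext_iff.1 h).2)

end Rectangles

section TwoLevels

variable {α V W : Type*} {k l : ℕ}

/-- The elements of a sequence without repetition, as a set. -/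
def entries (x : Fin k ↪ α) : Finset α := univ.map x

lemma apply_mem_entries (x : Fin k ↪ α) (i : Fin k) : x i ∈ entries x :=
  mem_map_of_mem x (mem_univ i)

variable [Fintype α]

/-- The elements which, after Bob's first entries up to `i`, the class of `u` at `(x, y)` makes
unlikely as his next one. -/
noncomputable def rareNext (u : (Fin k ↪ α) → (Fin l ↪ α) → V) (i : Fin l) (x : Fin k ↪ α)
    (y : Fin l ↪ α) : Finset α :=
  rare (entry i) (u x) (before i) y

lemma sum_expect_condMutualInfo_entry {Ω : Type*} [Fintype Ω] (z : (Fin k ↪ α) → Ω → V) :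
    ∑ j, 𝔼 y, condMutualInfo (entry j) (fun x => z x y) (before j) =
      𝔼 y, entropy fun x => z x y := by
  rw [← expect_sum_comm]
  exact expect_congr rfl fun y _ =>
    sum_condMutualInfo_initial_eq_entropy DFunLike.coe_injective _

lemma sum_expect_condMutualInfo_entry_of_factorsThrough {Ω : Type*} [Fintype Ω]
    {u : Ω → (Fin k ↪ α) → V} {w : Ω → (Fin k ↪ α) → W}
    (h : ∀ y, (u y).FactorsThrough (w y)) :
    ∑ j, 𝔼 y, condMutualInfo (entry j) (w y) (fun x => (before j x, u y x)) =
      𝔼 y, (entropy (w y) - entropy (u y)) := by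
  rw [← expect_sum_comm]
  refine expect_congr rfl fun y _ => ?_
  rw [← entropy_congr (p := fun x => (u y x, w y x)) (q := w y)
    (fun _ _ h' => (Prod.ext_iff.1 h').2) fun _ _ h' => Prod.ext (h y h') h']
  exact sum_condMutualInfo_initial_of_injective DFunLike.coe_injective _ _

variable {u : (Fin k ↪ α) → (Fin l ↪ α) → V} {w : (Fin k ↪ α) → (Fin l ↪ α) → W}
  {i : Fin l} {j : Fin k} {x x' : Fin k ↪ α} {y y' : Fin l ↪ α}

lemma rareNext_congr_left (hu : IsRect u) (h : u x y = u x' y) :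
    rareNext u i x y = rareNext u i x' y := by
  have same_fiber : fiber (fun a => (before i a, u x a)) y =
      fiber (fun a => (before i a, u x' a)) y := by
    ext a
    simp only [mem_fiber, Prod.mk.injEq, hu.apply_eq_apply_iff h]
  ext e
  simp only [rareNext, mem_rare, condProb, same_fiber]

lemma prob_mem_rareNext_le (hk : 2 * k ≤ Fintype.card α) (hu : IsRect u) :
    prob (fun x => x j ∈ rareNext u i x y) ≤
      2 * condMutualInfo (entry j) (fun x => u x y) (before j) +
        4 * 𝔼 x, (#(rareNext u i x y) / Fintype.card α : ℝ) := by
  have := log_mul_prob_entry_mem_le (i := j) (g := fun x => u x y)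
    (E := fun x => rareNext u i x y) hk
    (fun x x' h => rareNext_congr_left hu (Prod.ext_iff.1 h).2) zero_le_one
  rw [one_add_one_eq_two] at this
  nlinarith [Real.log_two_gt_d9, prob_nonneg fun x : Fin k ↪ α => x j ∈ rareNext u i x y]

variable [DecidableEq α]

/-- The elements which the class of `w` at `(x, y)` excludes as Bob's `i`-th entry without their
being rare for `u`: they are possible as Alice's `j`-th entry after her first entries, so that Bob
has such an element only if it lies in the intersection. -/
noncomputable def excluded (u : (Fin k ↪ α) → (Fin l ↪ α) → V)
    (w : (Fin k ↪ α) → (Fin l ↪ α) → W) (i : Fin l) (j : Fin k) (x : Fin k ↪ α) (y : Fin l ↪ α) :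
    Finset α :=
  ((fiber (fun x' => (before j x', w x' y)) x).image (entry j) \ (entries x ∩ entries y)) \
    rareNext u i x y

lemma mem_excluded_or_mem_rareNext_or_mem_entries :
    x j ∈ excluded u w i j x y ∨ x j ∈ rareNext u i x y ∨ x j ∈ entries y := by
  have possible : x j ∈ (fiber (fun x' => (before j x', w x' y)) x).image (entry j) :=
    mem_image_of_mem (entry j) (self_mem_fiber _ x)
  simp only [excluded, mem_sdiff, mem_inter]
  tauto

lemma excluded_congr_left (hu : IsRect u)
    (refines : ∀ ⦃x y x' y'⦄, w x y = w x' y' → u x y = u x' y')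
    (reveals : ∀ ⦃x y x' y'⦄, w x y = w x' y' → entries x ∩ entries y = entries x' ∩ entries y')
    (hx : before j x = before j x') (h : w x y = w x' y) :
    excluded u w i j x y = excluded u w i j x' y := by
  rw [excluded, excluded, reveals h, rareNext_congr_left hu (refines h),
    fiber_eq_fiber (Prod.ext hx h)]

lemma excluded_congr_right (hw : IsRect w)
    (reveals : ∀ ⦃x y x' y'⦄, w x y = w x' y' → entries x ∩ entries y = entries x' ∩ entries y')
    (hy : before i y = before i y') (hu : u x y = u x y') (h : w x y = w x y') :
    excluded u w i j x y = excluded u w i j x y' := by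
  have same_fiber : fiber (fun x' => (before j x', w x' y)) x =
      fiber (fun x' => (before j x', w x' y')) x := by
    ext a
    simp only [mem_fiber, Prod.mk.injEq]
    exact and_congr_right fun _ => hw.flip.apply_eq_apply_iff h a
  rw [excluded, excluded, reveals h, same_fiber, rareNext, rareNext,
    rare_factorsThrough (Prod.ext hy hu)]

lemma apply_notMem_excluded
    (reveals : ∀ ⦃x y x' y'⦄, w x y = w x' y' → entries x ∩ entries y = entries x' ∩ entries y') :
    y i ∉ excluded u w i j x y := by
  intro hy
  obtain ⟨possible, notMem⟩ := mem_sdiff.1 (mem_sdiff.1 hy).1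
  obtain ⟨x', hx', hxy⟩ := mem_image.1 possible
  have same_class : w x' y = w x y := (Prod.ext_iff.1 (mem_fiber.1 hx')).2
  refine notMem (reveals same_class ▸ mem_inter.2 ⟨?_, apply_mem_entries y i⟩)
  exact hxy ▸ apply_mem_entries x' j

lemma expect_card_excluded_div_le (hw : IsRect w)
    (reveals : ∀ ⦃x y x' y'⦄, w x y = w x' y' → entries x ∩ entries y = entries x' ∩ entries y') :
    𝔼 y, (#(excluded u w i j x y) / Fintype.card α : ℝ) ≤
      4 * condMutualInfo (entry i) (w x) (fun y => (before i y, u x y)) := by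
  refine expect_card_div_le (fun y y' h => ?_) (fun y => apply_notMem_excluded reveals)
    fun y => sdiff_disjoint
  have hbu : (before i y, u x y) = (before i y', u x y') := (Prod.ext_iff.1 h).1
  exact excluded_congr_right hw reveals (Prod.ext_iff.1 hbu).1 (Prod.ext_iff.1 hbu).2
    (Prod.ext_iff.1 h).2

lemma one_sub_le_expect_prob_mem_excluded (hk : 2 * k ≤ Fintype.card α)
    (hl : l ≤ Fintype.card α) (hu : IsRect u) (i : Fin l) (j : Fin k) :
    1 - 6 * (l / Fintype.card α) -
        2 * 𝔼 y, condMutualInfo (entry j) (fun x => u x y) (before j) -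
        40 / 3 * 𝔼 x, condMutualInfo (entry i) (u x) (before i) ≤
      𝔼 y, prob (fun x => x j ∈ excluded u w i j x y) := by
  have : Nonempty (Fin k ↪ α) := Function.Embedding.nonempty_of_card_le (by simp; omega)
  have : Nonempty (Fin l ↪ α) := Function.Embedding.nonempty_of_card_le (by simpa using hl)
  have cover : 1 ≤ 𝔼 y, prob (fun x => x j ∈ excluded u w i j x y) +
      𝔼 y, prob (fun x => x j ∈ rareNext u i x y) +
      𝔼 y : Fin l ↪ α, prob (fun x : Fin k ↪ α => x j ∈ entries y) := by
    simp only [← expect_add_distrib]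
    exact le_expect univ_nonempty fun y _ => one_le_prob_add_prob_add_prob fun x =>
      mem_excluded_or_mem_rareNext_or_mem_entries
  have entries_le : 𝔼 y : Fin l ↪ α, prob (fun x : Fin k ↪ α => x j ∈ entries y) ≤
      2 * (l / Fintype.card α) :=
    expect_le univ_nonempty fun y _ => (prob_entry_mem_le hk _ j).trans_eq <| by
      rw [entries, card_map, card_fin, mul_div_assoc]
  have rareNext_le := expect_le_expect fun y (_ : y ∈ univ) =>
    prob_mem_rareNext_le (i := i) (j := j) (y := y) hk hu
  have card_rareNext_le := expect_le_expect fun x (_ : x ∈ univ) =>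
    expect_card_rare_div_le i (u x)
  simp only [expect_add_distrib, ← mul_expect, Fintype.expect_const]
    at rareNext_le card_rareNext_le
  rw [expect_comm] at card_rareNext_le
  simp only [rareNext] at rareNext_le cover
  linarith

lemma log_mul_le_condMutualInfo (hk : 2 * k ≤ Fintype.card α) (hl : l ≤ Fintype.card α)
    (hu : IsRect u) (hw : IsRect w)
    (refines : ∀ ⦃x y x' y'⦄, w x y = w x' y' → u x y = u x' y')
    (reveals : ∀ ⦃x y x' y'⦄, w x y = w x' y' → entries x ∩ entries y = entries x' ∩ entries y')
    {M : ℝ} (hM : 0 ≤ M) (i : Fin l) (j : Fin k) :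
    Real.log (1 + M) * (1 - 6 * (l / Fintype.card α) -
        2 * 𝔼 y, condMutualInfo (entry j) (fun x => u x y) (before j) -
        40 / 3 * 𝔼 x, condMutualInfo (entry i) (u x) (before i)) ≤
      𝔼 y, condMutualInfo (entry j) (fun x => w x y) (before j) +
        8 * M * 𝔼 x, condMutualInfo (entry i) (w x) (fun y => (before i y, u x y)) := by
  have log_nonneg : 0 ≤ Real.log (1 + M) := Real.log_nonneg (by linarith)
  have prob_excluded_ge := one_sub_le_expect_prob_mem_excluded (w := w) hk hl hu i j
  have excluded_le := expect_le_expect fun y (_ : y ∈ univ) =>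
    log_mul_prob_entry_mem_le (g := fun x => w x y) (E := fun x => excluded u w i j x y) hk
      (fun x x' h => excluded_congr_left hu refines reveals (Prod.ext_iff.1 h).1
        (Prod.ext_iff.1 h).2) hM
  have card_excluded_le := expect_le_expect fun x (_ : x ∈ univ) =>
    expect_card_excluded_div_le (u := u) (i := i) (j := j) (x := x) hw reveals
  simp only [expect_add_distrib, ← mul_expect] at excluded_le card_excluded_le
  rw [expect_comm] at card_excluded_le
  linarith [mul_le_mul_of_nonneg_left prob_excluded_ge log_nonneg,
    mul_le_mul_of_nonneg_left card_excluded_le hM]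

lemma log_mul_le_entropy (hk : 2 * k ≤ Fintype.card α) (hl : l ≤ Fintype.card α)
    (hu : IsRect u) (hw : IsRect w)
    (refines : ∀ ⦃x y x' y'⦄, w x y = w x' y' → u x y = u x' y')
    (reveals : ∀ ⦃x y x' y'⦄, w x y = w x' y' → entries x ∩ entries y = entries x' ∩ entries y')
    {M : ℝ} (hM : 0 ≤ M) :
    Real.log (1 + M) * (k * l * (1 - 6 * (l / Fintype.card α)) -
        2 * l * 𝔼 y, entropy (fun x => u x y) - 40 / 3 * k * 𝔼 x, entropy (u x)) ≤
      l * 𝔼 y, entropy (fun x => w x y) +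
        8 * M * k * 𝔼 x, (entropy (w x) - entropy (u x)) := by
  have pairs := sum_le_sum fun i (_ : i ∈ univ) => sum_le_sum fun j (_ : j ∈ univ) =>
    log_mul_le_condMutualInfo hk hl hu hw refines reveals hM i j
  simp only [← mul_sum, sum_sub_distrib, sum_add_distrib, sum_const, card_univ, Fintype.card_fin,
    nsmul_eq_mul, sum_expect_condMutualInfo_entry] at pairs
  rw [sum_expect_condMutualInfo_entry_of_factorsThrough fun x y y' h => refines h] at pairs
  linarith

end TwoLevels

end SetInt

namespace ProtocolTree

open Finset SetInt
open scoped BigOperators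

variable {X Y γ : Type*} {T : ProtocolTree X Y γ} {x x' : X} {y y' : Y} {p : Player}
  {v : List Bool} {m n N : ℕ}

/-- The bit which player `p` sends at the node `v` on the input `(x, y)`. -/
def bit (T : ProtocolTree X Y γ) : Player → List Bool → X → Y → Bool
  | Player.alice, v, x, _ => T.bitA v x
  | Player.bob, v, _, y => T.bitB v y

open Classical in
/-- The number of bits which player `p` sends in the first `N` rounds on the input `(x, y)`. -/
noncomputable def bitsWithin (T : ProtocolTree X Y γ) (p : Player) (N : ℕ) (x : X) (y : Y) : ℕ :=
  #{n ∈ range N | T.node (T.run x y n) = some p}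

lemma bit_eq_bit_of_ne_alice (hp : p ≠ Player.alice) : T.bit p v x y = T.bit p v x' y := by
  cases p
  exacts [absurd rfl hp, rfl]

lemma bit_eq_bit_of_ne_bob (hp : p ≠ Player.bob) : T.bit p v x y = T.bit p v x y' := by
  cases p
  exacts [rfl, absurd rfl hp]

lemma step_of_node_eq_none (h : T.node v = none) : T.step x y v = v := by
  rw [step, h]

lemma step_of_node_eq_some (h : T.node v = some p) : T.step x y v = v ++ [T.bit p v x y] := by
  cases p <;> rw [step, h] <;> rfl

lemma step_congr (h : ∀ p, T.node v = some p → T.bit p v x y = T.bit p v x' y') :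
    T.step x y v = T.step x' y' v := by
  cases hv : T.node v with
  | none => rw [step_of_node_eq_none hv, step_of_node_eq_none hv]
  | some p => rw [step_of_node_eq_some hv, step_of_node_eq_some hv, h p hv]

lemma run_succ (T : ProtocolTree X Y γ) (x : X) (y : Y) (n : ℕ) :
    T.run x y (n + 1) = T.step x y (T.run x y n) :=
  Function.iterate_succ_apply' ..

lemma run_succ_of_node_eq_none (h : T.node (T.run x y n) = none) :
    T.run x y (n + 1) = T.run x y n := by
  rw [run_succ, step_of_node_eq_none h]

lemma run_eq_of_node_eq_none (hmn : m ≤ n) (h : T.node (T.run x y m) = none) :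
    T.run x y n = T.run x y m := by
  induction n, hmn using Nat.le_induction with
  | base => rfl
  | succ n _ ih => rw [run_succ_of_node_eq_none (ih ▸ h), ih]

lemma run_prefix_run_succ (T : ProtocolTree X Y γ) (x : X) (y : Y) (n : ℕ) :
    T.run x y n <+: T.run x y (n + 1) := by
  rw [run_succ]
  cases h : T.node (T.run x y n) with
  | none => rw [step_of_node_eq_none h]
  | some p => rw [step_of_node_eq_some h]; exact List.prefix_append _ _

lemma length_run (h : T.node (T.run x y n) ≠ none) : (T.run x y n).length = n := by
  induction n with
  | zero => rfl
  | succ n ih =>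
    have active : T.node (T.run x y n) ≠ none := fun h' => h (by rwa [run_succ_of_node_eq_none h'])
    obtain ⟨p, hp⟩ := Option.ne_none_iff_exists'.1 active
    rw [run_succ, step_of_node_eq_some hp, List.length_append, ih active, List.length_singleton]

lemma length_run_le (T : ProtocolTree X Y γ) (x : X) (y : Y) (n : ℕ) :
    (T.run x y n).length ≤ n := by
  induction n with
  | zero => rfl
  | succ n ih =>
    cases h : T.node (T.run x y n) with
    | none => rw [run_succ_of_node_eq_none h]; omega
    | some p =>
      rw [run_succ, step_of_node_eq_some h, List.length_append, List.length_singleton]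
      omega

lemma run_eq_take (T : ProtocolTree X Y γ) (x : X) (y : Y) (n : ℕ) :
    T.run x y n = (T.run x y (n + 1)).take n := by
  cases h : T.node (T.run x y n) with
  | none => rw [run_succ_of_node_eq_none h, List.take_of_length_le (length_run_le T x y n)]
  | some p =>
    rw [run_succ, step_of_node_eq_some h, List.take_left' (length_run (by simp [h]))]

lemma run_eq_of_le (hmn : m ≤ n) (h : T.run x y n = T.run x' y' n) :
    T.run x y m = T.run x' y' m := by
  induction n, hmn using Nat.le_induction with
  | base => exact h
  | succ n _ ih => exact ih (by rw [run_eq_take, h, ← run_eq_take])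

lemma isRect_run (T : ProtocolTree X Y γ) (n : ℕ) : IsRect fun x y => T.run x y n := by
  induction n with
  | zero => exact fun _ _ _ _ _ => rfl
  | succ n ih =>
    intro x y x' y' h
    have same_run : T.run x y n = T.run x' y' n := run_eq_of_le n.le_succ h
    have mixed_run : T.run x y' n = T.run x y n := ih same_run
    simp only [run_succ, ← same_run, mixed_run] at h ⊢
    cases hv : T.node (T.run x y n) with
    | none => rw [step_of_node_eq_none hv, step_of_node_eq_none hv]
    | some p =>
      cases p with
      | alice => rw [step_of_node_eq_some hv, step_of_node_eq_some hv]; rfl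
      | bob => rw [h, step_of_node_eq_some hv, step_of_node_eq_some hv]; rfl

lemma eq_of_run_eq {f : X → Y → γ} (hA : ∀ x y, T.outA (T.run x y n) x = f x y)
    (hB : ∀ x y, T.outB (T.run x y n) y = f x y) (h : T.run x y n = T.run x' y' n) :
    f x y = f x' y' := by
  have mixed_run : T.run x y' n = T.run x y n := isRect_run T n h
  rw [← hA x y, ← mixed_run, hA, ← hB x y', mixed_run, h, hB]

section Entropy

variable {Ω : Type*} {x : Ω → X} {y : Ω → Y} {ω ω' : Ω}

lemma run_succ_congr
    (others : ∀ q, q ≠ p → ∀ v ω ω', T.bit q v (x ω) (y ω) = T.bit q v (x ω') (y ω'))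
    (hrun : T.run (x ω) (y ω) n = T.run (x ω') (y ω') n)
    (hbit : T.node (T.run (x ω) (y ω) n) = some p →
      T.bit p (T.run (x ω) (y ω) n) (x ω) (y ω) = T.bit p (T.run (x ω') (y ω') n) (x ω') (y ω')) :
    T.run (x ω) (y ω) (n + 1) = T.run (x ω') (y ω') (n + 1) := by
  rw [run_succ, run_succ, ← hrun]
  refine step_congr fun q hq => ?_
  by_cases hqp : q = p
  · subst hqp
    rw [hbit hq, hrun]
  · exact others q hqp _ ω ω'

lemma entropy_run_le [Fintype Ω] (p : Player) (N : ℕ)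
    (others : ∀ q, q ≠ p → ∀ v ω ω', T.bit q v (x ω) (y ω) = T.bit q v (x ω') (y ω')) :
    entropy (fun ω => T.run (x ω) (y ω) N) ≤
      Real.log 2 * 𝔼 ω, (T.bitsWithin p N (x ω) (y ω) : ℝ) := by
  classical
  have bound := entropy_process_le (R := fun n ω => T.run (x ω) (y ω) n) (N := N)
    (Q := fun v => T.node v = some p) fun n _ ω ω' => run_succ_congr others
  have start : entropy (fun ω => T.run (x ω) (y ω) 0) = 0 := entropy_const []
  rw [start, zero_add] at bound
  simpa only [bitsWithin] using bound

end Entropy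

end ProtocolTree

namespace TwoPhaseTree

open Finset SetInt ProtocolTree
open scoped BigOperators

variable {X Y γ : Type*} {T : TwoPhaseTree X Y γ} {x x' : X} {y y' : Y} {p : Player}
  {v w : List Bool} {n N : ℕ}

open Classical in
/-- The number of bits which player `p` sends in phase `i` within the first `N` rounds on the input
`(x, y)`. -/
noncomputable def bitsWithin (T : TwoPhaseTree X Y γ) (p : Player) (i : Phase) (N : ℕ)
    (x : X) (y : Y) : ℕ :=
  #{n ∈ range N | T.node (T.run x y n) = some p ∧ T.phase (T.run x y n) = i}

open Classical in
/-- The protocol which stops as soon as phase two begins. -/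
noncomputable def phaseOneTree (T : TwoPhaseTree X Y γ) : ProtocolTree X Y γ where
  __ := T.toProtocolTree
  node v := if T.phase v = Phase.one then T.node v else none

lemma phase_eq_one_of_prefix (hvw : v <+: w) (hw : T.phase w = Phase.one) :
    T.phase v = Phase.one := by
  simp only [phase, ite_eq_right_iff, reduceCtorEq, imp_false] at hw ⊢
  exact fun ⟨u, huv, hu⟩ => hw ⟨u, huv.trans hvw, hu⟩

lemma phase_eq_two_iff : T.phase v = Phase.two ↔ T.phase v ≠ Phase.one := by
  cases T.phase v <;> simp

lemma phaseOneTree_node (h : T.phase v = Phase.one) : T.phaseOneTree.node v = T.node v :=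
  if_pos h

lemma phaseOneTree_node_eq_some_iff :
    T.phaseOneTree.node v = some p ↔ T.node v = some p ∧ T.phase v = Phase.one := by
  by_cases h : T.phase v = Phase.one <;> simp [phaseOneTree, h]

lemma phaseOneTree_bit (T : TwoPhaseTree X Y γ) : T.phaseOneTree.bit = T.bit := by
  funext p
  cases p <;> rfl

lemma phaseOneTree_step (h : T.phase v = Phase.one) :
    T.phaseOneTree.step x y v = T.step x y v := by
  simp only [ProtocolTree.step, phaseOneTree_node h]
  rfl

lemma phaseOneTree_run (h : T.phase (T.run x y n) = Phase.one) :
    T.phaseOneTree.run x y n = T.run x y n := by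
  induction n with
  | zero => rfl
  | succ n ih =>
    have phase_one := phase_eq_one_of_prefix (run_prefix_run_succ T.toProtocolTree x y n) h
    rw [run_succ, run_succ, ih phase_one, phaseOneTree_step phase_one]

lemma phaseOneTree_run_succ (h : T.phase (T.run x y n) = Phase.one) :
    T.phaseOneTree.run x y (n + 1) = T.run x y (n + 1) := by
  rw [run_succ, run_succ, phaseOneTree_run h, phaseOneTree_step h]

lemma phaseOneTree_run_of_node_eq_some
    (h : T.phaseOneTree.node (T.phaseOneTree.run x y n) = some p) :
    T.phaseOneTree.run x y n = T.run x y n := by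
  induction n generalizing p with
  | zero => rfl
  | succ n ih =>
    have active : T.phaseOneTree.node (T.phaseOneTree.run x y n) ≠ none := fun h' => by
      rw [run_succ_of_node_eq_none h', h'] at h
      cases h
    obtain ⟨q, hq⟩ := Option.ne_none_iff_exists'.1 active
    exact phaseOneTree_run_succ (ih hq ▸ (phaseOneTree_node_eq_some_iff.1 hq).2)

lemma bitsWithin_phaseOneTree_le (T : TwoPhaseTree X Y γ) (p : Player) (N : ℕ) (x : X) (y : Y) :
    T.phaseOneTree.bitsWithin p N x y ≤ T.bitsWithin p Phase.one N x y := by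
  classical
  refine card_le_card (monotone_filter_right _ fun n _ hn => ?_)
  rw [← phaseOneTree_run_of_node_eq_some hn]
  exact phaseOneTree_node_eq_some_iff.1 hn

lemma bitsWithin_le_bits (T : TwoPhaseTree X Y γ) (p : Player) (i : Phase) (N : ℕ)
    (x : X) (y : Y) : (T.bitsWithin p i N x y : ℝ≥0∞) ≤ T.bits p i x y := by
  rw [bitsWithin, card_filter, Nat.cast_sum]
  simp only [Nat.cast_ite, Nat.cast_one, Nat.cast_zero]
  exact ENNReal.sum_le_tsum (range N)

section Entropy

variable {Ω : Type*} [Fintype Ω] {x : Ω → X} {y : Ω → Y} (p : Player) (N : ℕ)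

lemma entropy_phaseOneTree_run_le
    (others : ∀ q, q ≠ p → ∀ v ω ω', T.bit q v (x ω) (y ω) = T.bit q v (x ω') (y ω')) :
    entropy (fun ω => T.phaseOneTree.run (x ω) (y ω) N) ≤
      Real.log 2 * 𝔼 ω, (T.bitsWithin p Phase.one N (x ω) (y ω) : ℝ) := by
  refine (entropy_run_le p N (by rwa [phaseOneTree_bit])).trans ?_
  gcongr
  exact bitsWithin_phaseOneTree_le T p N _ _

lemma entropy_run_sub_entropy_phaseOneTree_run_le
    (others : ∀ q, q ≠ p → ∀ v ω ω', T.bit q v (x ω) (y ω) = T.bit q v (x ω') (y ω')) :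
    entropy (fun ω => (T.phaseOneTree.run (x ω) (y ω) N, T.run (x ω) (y ω) N)) -
        entropy (fun ω => T.phaseOneTree.run (x ω) (y ω) N) ≤
      Real.log 2 * 𝔼 ω, (T.bitsWithin p Phase.two N (x ω) (y ω) : ℝ) := by
  classical
  let R n ω := (T.phaseOneTree.run (x ω) (y ω) N, T.run (x ω) (y ω) n)
  have next_determined : ∀ n < N, ∀ ω ω', R n ω = R n ω' →
      (T.node (R n ω).2 = some p ∧ T.phase (R n ω).2 = Phase.two →
        T.bit p (R n ω).2 (x ω) (y ω) = T.bit p (R n ω').2 (x ω') (y ω')) →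
      R (n + 1) ω = R (n + 1) ω' := by
    intro n hn ω ω' hR hbit
    obtain ⟨hN, hrun⟩ := Prod.ext_iff.1 hR
    refine Prod.ext hN ?_
    simp only [R] at hN hrun hbit ⊢
    by_cases phase_one : T.phase (T.run (x ω) (y ω) n) = Phase.one
    · rw [← phaseOneTree_run_succ phase_one, ← phaseOneTree_run_succ (hrun ▸ phase_one)]
      exact run_eq_of_le hn hN
    · exact run_succ_congr others hrun fun hp => hbit ⟨hp, phase_eq_two_iff.2 phase_one⟩
  have bound := entropy_process_le (R := R)
    (Q := fun r => T.node r.2 = some p ∧ T.phase r.2 = Phase.two) next_determined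
  have start : entropy (R 0) = entropy fun ω => T.phaseOneTree.run (x ω) (y ω) N :=
    entropy_congr (fun ω ω' h => (Prod.ext_iff.1 h).1) fun ω ω' h => Prod.ext h rfl
  rw [start] at bound
  simp only [bitsWithin]
  exact sub_left_le_of_le_add bound

end Entropy

end TwoPhaseTree

namespace SetInt

/-- Bits per player and phase: the theorem says that for some `p` and `i` the cost exceeds a
constant multiple of `budget k l r p i`. -/
noncomputable def budget (k l : ℕ) (r : ℝ) : Player → Phase → ℝ
  | Player.alice, Phase.one => k
  | Player.bob, Phase.one => l
  | Player.alice, Phase.two => k * Real.logb 2 r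
  | Player.bob, Phase.two => k / r

lemma budget_pos {k l : ℕ} (hk : 0 < k) (hl : 0 < l) {r : ℝ} (hr : 1 < r) (p : Player)
    (i : Phase) : 0 < budget k l r p i := by
  have logb_pos := Real.logb_pos one_lt_two hr
  cases p <;> cases i <;> simp only [budget] <;> positivity

end SetInt

namespace TwoPhaseTree

open Finset SetInt ProtocolTree
open scoped BigOperators

section MeanBits

variable {X Y γ : Type*} [Fintype X] [Fintype Y]

/-- The average number of bits which player `p` sends in phase `i` within the first `N` rounds,
for uniformly random inputs. -/
noncomputable def meanBits (T : TwoPhaseTree X Y γ) (p : Player) (i : Phase) (N : ℕ) : ℝ :=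
  𝔼 x, 𝔼 y, (T.bitsWithin p i N x y : ℝ)

variable (T : TwoPhaseTree X Y γ) (N : ℕ)

lemma meanBits_nonneg (p : Player) (i : Phase) : 0 ≤ T.meanBits p i N :=
  expect_nonneg fun _ _ => expect_nonneg fun _ _ => Nat.cast_nonneg _

lemma expect_entropy_phaseOneTree_run_le_alice :
    𝔼 y, entropy (fun x => T.phaseOneTree.run x y N) ≤
      Real.log 2 * T.meanBits Player.alice Phase.one N := by
  rw [meanBits, expect_comm, mul_expect]
  exact expect_le_expect fun y _ => entropy_phaseOneTree_run_le (x := id) (y := fun _ => y)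
    Player.alice N fun _ hq _ _ _ => bit_eq_bit_of_ne_alice hq

lemma expect_entropy_phaseOneTree_run_le_bob :
    𝔼 x, entropy (fun y => T.phaseOneTree.run x y N) ≤
      Real.log 2 * T.meanBits Player.bob Phase.one N := by
  rw [meanBits, mul_expect]
  exact expect_le_expect fun x _ => entropy_phaseOneTree_run_le (x := fun _ => x) (y := id)
    Player.bob N fun _ hq _ _ _ => bit_eq_bit_of_ne_bob hq

lemma expect_entropy_run_sub_le_alice :
    𝔼 y, (entropy (fun x => (T.phaseOneTree.run x y N, T.run x y N)) -
        entropy (fun x => T.phaseOneTree.run x y N)) ≤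
      Real.log 2 * T.meanBits Player.alice Phase.two N := by
  rw [meanBits, expect_comm, mul_expect]
  exact expect_le_expect fun y _ => entropy_run_sub_entropy_phaseOneTree_run_le (x := id)
    (y := fun _ => y) Player.alice N fun _ hq _ _ _ => bit_eq_bit_of_ne_alice hq

lemma expect_entropy_run_sub_le_bob :
    𝔼 x, (entropy (fun y => (T.phaseOneTree.run x y N, T.run x y N)) -
        entropy (fun y => T.phaseOneTree.run x y N)) ≤
      Real.log 2 * T.meanBits Player.bob Phase.two N := by
  rw [meanBits, mul_expect]
  exact expect_le_expect fun x _ => entropy_run_sub_entropy_phaseOneTree_run_le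
    (x := fun _ => x) (y := id) Player.bob N fun _ hq _ _ _ => bit_eq_bit_of_ne_bob hq

end MeanBits

section SetIntersection

variable {α : Type*} [Fintype α] [DecidableEq α] {k l : ℕ}
  {T : TwoPhaseTree (Fin k ↪ α) (Fin l ↪ α) (Finset α)} {N : ℕ}

lemma log_mul_le_meanBits (hk : 2 * k ≤ Fintype.card α) (hl : l ≤ Fintype.card α)
    (hA : ∀ x y, T.outA (T.run x y N) x = entries x ∩ entries y)
    (hB : ∀ x y, T.outB (T.run x y N) y = entries x ∩ entries y) {M : ℝ} (hM : 0 ≤ M) :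
    Real.log (1 + M) * (k * l * (1 - 6 * (l / Fintype.card α)) -
        2 * l * (Real.log 2 * T.meanBits Player.alice Phase.one N) -
        40 / 3 * k * (Real.log 2 * T.meanBits Player.bob Phase.one N)) ≤
      l * (Real.log 2 * T.meanBits Player.alice Phase.one N +
          Real.log 2 * T.meanBits Player.alice Phase.two N) +
        8 * M * k * (Real.log 2 * T.meanBits Player.bob Phase.two N) := by
  have main := log_mul_le_entropy hk hl (isRect_run T.phaseOneTree N)
    ((isRect_run T.phaseOneTree N).prodMk (isRect_run T.toProtocolTree N))
    (fun _ _ _ _ h => (Prod.ext_iff.1 h).1)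
    (fun _ _ _ _ h => eq_of_run_eq (f := fun x y => entries x ∩ entries y) hA hB
      (Prod.ext_iff.1 h).2) hM
  have log_nonneg : 0 ≤ Real.log (1 + M) := Real.log_nonneg (by linarith)
  have alice_one := expect_entropy_phaseOneTree_run_le_alice T N
  have bob_one := expect_entropy_phaseOneTree_run_le_bob T N
  have alice_two := expect_entropy_run_sub_le_alice T N
  have bob_two := expect_entropy_run_sub_le_bob T N
  rw [expect_sub_distrib] at alice_two
  refine le_trans ?_ (main.trans ?_)
  · gcongr
  · gcongr
    linarith

lemma one_sub_le_meanBits (hk : 0 < k) (hl : 0 < l) (hkα : 2 * k ≤ Fintype.card α)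
    (hlα : l ≤ Fintype.card α)
    (hA : ∀ x y, T.outA (T.run x y N) x = entries x ∩ entries y)
    (hB : ∀ x y, T.outB (T.run x y N) y = entries x ∩ entries y) {M : ℝ} (hM : 1 ≤ M) :
    1 - 6 * (l / Fintype.card α : ℝ) ≤
      3 * (T.meanBits Player.alice Phase.one N / k) +
        14 * (T.meanBits Player.bob Phase.one N / l) +
        T.meanBits Player.alice Phase.two N / (k * Real.logb 2 (1 + M)) +
        8 * M * (T.meanBits Player.bob Phase.two N / l) := by
  have main := log_mul_le_meanBits hkα hlα hA hB (zero_le_one.trans hM)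
  have k_pos : (0 : ℝ) < k := Nat.cast_pos.2 hk
  have l_pos : (0 : ℝ) < l := Nat.cast_pos.2 hl
  have log_two_pos : 0 < Real.log 2 := Real.log_pos one_lt_two
  have log_two_le : Real.log 2 ≤ 1 := Real.log_two_lt_d9.le.trans (by norm_num)
  rw [← Real.log_div_log]
  set Λ := Real.log (1 + M)
  have log_two_le_Λ : Real.log 2 ≤ Λ := Real.log_le_log two_pos (by linarith)
  have Λ_pos : 0 < Λ := log_two_pos.trans_le log_two_le_Λ
  have alice_one_nonneg := T.meanBits_nonneg N Player.alice Phase.one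
  have bob_one_nonneg := T.meanBits_nonneg N Player.bob Phase.one
  have bob_two_nonneg := T.meanBits_nonneg N Player.bob Phase.two
  set a₁ := T.meanBits Player.alice Phase.one N
  set b₁ := T.meanBits Player.bob Phase.one N
  set b₂ := T.meanBits Player.bob Phase.two N
  clear_value a₁ b₁ b₂ Λ
  refine le_of_mul_le_mul_right ?_ (mul_pos (mul_pos k_pos l_pos) Λ_pos)
  calc
    _ ≤ 2 * l * (Real.log 2 * a₁) * Λ + l * (Real.log 2 * a₁) +
        40 / 3 * k * (Real.log 2 * b₁) * Λ +
        l * (Real.log 2 * T.meanBits Player.alice Phase.two N) +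
        8 * M * k * (Real.log 2 * b₂) := by linarith
    _ ≤ 2 * l * (1 * a₁) * Λ + l * (Λ * a₁) + 14 * k * (1 * b₁) * Λ +
        l * (Real.log 2 * T.meanBits Player.alice Phase.two N) +
        8 * M * k * (Λ * b₂) := by gcongr; norm_num
    _ = _ := by field_simp; ring

lemma exists_budget_div_lt_meanBits (hk : 1 ≤ k) (hkl : k ≤ l) (hl : 100 * l ≤ Fintype.card α)
    (hA : ∀ x y, T.outA (T.run x y N) x = entries x ∩ entries y)
    (hB : ∀ x y, T.outB (T.run x y N) y = entries x ∩ entries y) {r : ℝ} (hr : 1 < r) :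
    ∃ p i, budget k l r p i / 50 < T.meanBits p i N := by
  by_contra! cheap
  have tradeoff := one_sub_le_meanBits hk (hk.trans hkl) (by omega) (by omega) hA hB hr.le
  have k_pos : (0 : ℝ) < k := Nat.cast_pos.2 hk
  have l_pos : (0 : ℝ) < l := Nat.cast_pos.2 (hk.trans hkl)
  have logb_pos : 0 < Real.logb 2 (1 + r) := Real.logb_pos one_lt_two (by linarith)
  have l_div_card_le : (l / Fintype.card α : ℝ) ≤ 1 / 100 := by
    have card_ge : 100 * (l : ℝ) ≤ Fintype.card α := by exact_mod_cast hl
    rw [div_le_div_iff₀ (by linarith) (by norm_num)]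
    linarith
  have alice_one : T.meanBits Player.alice Phase.one N / k ≤ 1 / 50 :=
    (div_le_iff₀ k_pos).2 ((cheap _ _).trans_eq (by rw [budget]; ring))
  have bob_one : T.meanBits Player.bob Phase.one N / l ≤ 1 / 50 :=
    (div_le_iff₀ l_pos).2 ((cheap _ _).trans_eq (by rw [budget]; ring))
  have alice_two : T.meanBits Player.alice Phase.two N / (k * Real.logb 2 (1 + r)) ≤ 1 / 50 := by
    refine (div_le_iff₀ (by positivity)).2 ((cheap _ _).trans ?_)
    rw [budget, div_eq_inv_mul, ← one_div]
    gcongr <;> linarith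
  have bob_two : r * (T.meanBits Player.bob Phase.two N / l) ≤ 1 / 50 := calc
    _ ≤ r * (k / r / 50 / l) := by gcongr; exact cheap _ _
    _ = 1 / 50 * (k / l) := by field_simp
    _ ≤ 1 / 50 * 1 := by gcongr; exact div_le_one_of_le₀ (by exact_mod_cast hkl) l_pos.le
    _ = 1 / 50 := mul_one _
  linarith

end SetIntersection

section Comap

variable {X Y α β γ : Type*}

/-- The protocol in which the players act on `f x` and `g y` instead of on their inputs `x` and
`y`. -/
def comap (T : TwoPhaseTree α β γ) (f : X → α) (g : Y → β) : TwoPhaseTree X Y γ where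
  node := T.node
  bitA v x := T.bitA v (f x)
  bitB v y := T.bitB v (g y)
  outA v x := T.outA v (f x)
  outB v y := T.outB v (g y)
  marked := T.marked
  marked_unique := T.marked_unique

lemma exists_halting_time_comap [Finite X] [Finite Y] {T : TwoPhaseTree α β γ} {f : X → α}
    {g : Y → β} {z : X → Y → γ} (h : ∀ x y, T.BothOutput (f x) (g y) (z x y)) :
    ∃ N, (∀ x y, (T.comap f g).outA ((T.comap f g).run x y N) x = z x y) ∧
      ∀ x y, (T.comap f g).outB ((T.comap f g).run x y N) y = z x y := by
  choose t leaf answerA answerB using h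
  obtain ⟨N, hN⟩ := (Set.finite_range fun p : X × Y => t p.1 p.2).bddAbove
  have run_eq x y : (T.comap f g).run x y N = T.run (f x) (g y) (t x y) :=
    run_eq_of_node_eq_none (T := T.toProtocolTree) (hN ⟨(x, y), rfl⟩) (leaf x y)
  exact ⟨N, fun x y => run_eq x y ▸ answerA x y, fun x y => run_eq x y ▸ answerB x y⟩

lemma meanBits_comap_le [Fintype X] [Fintype Y] [Nonempty X] [Nonempty Y]
    {T : TwoPhaseTree α β γ} {f : X → α} {g : Y → β} {p : Player} {i : Phase} {c : ℝ} (hc : 0 ≤ c)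
    (h : ∑ x, ∑ y, T.bits p i (f x) (g y) ≤
      Fintype.card X * Fintype.card Y * ENNReal.ofReal c) (N : ℕ) :
    (T.comap f g).meanBits p i N ≤ c := by
  have sum_le : ∑ x, ∑ y, ((T.comap f g).bitsWithin p i N x y : ℝ≥0∞) ≤
      ENNReal.ofReal (Fintype.card X * Fintype.card Y * c) := by
    rw [ENNReal.ofReal_mul (by positivity), ENNReal.ofReal_mul (by positivity),
      ENNReal.ofReal_natCast, ENNReal.ofReal_natCast]
    exact (sum_le_sum fun x _ => sum_le_sum fun y _ =>
      bitsWithin_le_bits (T.comap f g) p i N x y).trans h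
  have sum_le_real := ENNReal.toReal_le_of_le_ofReal (by positivity) sum_le
  simp only [← Nat.cast_sum, ENNReal.toReal_natCast] at sum_le_real
  simp only [meanBits, Fintype.expect_eq_sum_div_card, ← sum_div, ← Nat.cast_sum]
  rw [div_div, div_le_iff₀ (by positivity)]
  linarith

end Comap

end TwoPhaseTree

instance : Fintype Player := ⟨⟨{Player.alice, Player.bob}, by simp⟩, by rintro (_ | _) <;> simp⟩

instance : Fintype Phase := ⟨⟨{Phase.one, Phase.two}, by simp⟩, by rintro (_ | _) <;> simp⟩

namespace SetInt

open Finset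

variable {Ω ι : Type*} [MeasurableSpace Ω]

lemma measurableSet_ofPred_apply_apply [Countable ι] {f : Ω → ι} {q : ι → Ω → Prop}
    (hf : ∀ i, MeasurableSet {ω | f ω = i}) (hq : ∀ i, MeasurableSet {ω | q i ω}) :
    MeasurableSet {ω | q (f ω) ω} := by
  have cover : {ω | q (f ω) ω} = ⋃ i, {ω | f ω = i} ∩ {ω | q i ω} := by
    ext ω
    simp
  exact cover ▸ MeasurableSet.iUnion fun i => (hf i).inter (hq i)

lemma exists_forall_le_card_mul [Fintype ι] {μ : Measure Ω} [IsProbabilityMeasure μ]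
    {f : ι → Ω → ℝ≥0∞} (hf : ∀ i, Measurable (f i)) {t : ι → ℝ≥0∞} (ht : ∀ i, t i ≠ 0)
    (ht' : ∀ i, t i ≠ ∞) (hft : ∀ i, ∫⁻ ω, f i ω ∂μ ≤ t i) {q : Ω → Prop} (hq : ∀ᵐ ω ∂μ, q ω) :
    ∃ ω, q ω ∧ ∀ i, f i ω ≤ Fintype.card ι * t i := by
  have sum_measurable : Measurable fun ω => ∑ i, f i ω / t i :=
    Finset.measurable_fun_sum _ fun i _ => (hf i).div_const _
  have lintegral_le : ∫⁻ ω, ∑ i, f i ω / t i ∂μ ≤ Fintype.card ι := by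
    simp only [div_eq_mul_inv]
    rw [lintegral_finsetSum _ fun i _ => (hf i).mul_const _]
    refine (sum_le_card_nsmul univ _ 1 fun i _ => ?_).trans_eq (by simp)
    rw [lintegral_mul_const _ (hf i), ← div_eq_mul_inv]
    exact ENNReal.div_le_of_le_mul (by simpa using hft i)
  obtain ⟨ω, hω, hle⟩ := exists_notMem_null_le_lintegral sum_measurable.aemeasurable (ae_iff.1 hq)
  refine ⟨ω, not_not.1 hω, fun i => (ENNReal.div_le_iff (ht i) (ht' i)).1 ?_⟩
  exact (single_le_sum (f := fun i => f i ω / t i) (fun _ _ => zero_le) (mem_univ i)).trans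
    (hle.trans lintegral_le)

end SetInt

namespace TwoPhaseProtocol

open ProtocolTree SetInt

variable {α β γ : Type*} (P : TwoPhaseProtocol.{u} α β γ) (x : α) (y : β)

instance : IsProbabilityMeasure P.law :=
  inferInstanceAs (IsProbabilityMeasure (P.lawPub.prod (P.lawA.prod P.lawB)))

lemma measurableSet_node_eq (v : List Bool) (s : Option Player) :
    MeasurableSet {ω : P.Pub × P.CoinA × P.CoinB | (P.tree ω.1).node v = s} :=
  measurable_fst (P.measurableSet_node v s)

lemma measurable_bit (p : Player) (v : List Bool) :
    Measurable fun ω : P.Pub × P.CoinA × P.CoinB =>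
      (P.tree ω.1).bit p v (x, ω.2.1) (y, ω.2.2) := by
  cases p with
  | alice => exact (P.measurable_bitA v x).comp (measurable_fst.prodMk measurable_snd.fst)
  | bob => exact (P.measurable_bitB v y).comp (measurable_fst.prodMk measurable_snd.snd)

lemma measurableSet_step_eq (v w : List Bool) :
    MeasurableSet {ω : P.Pub × P.CoinA × P.CoinB |
      (P.tree ω.1).step (x, ω.2.1) (y, ω.2.2) v = w} := by
  have step_eq_iff (ω : P.Pub × P.CoinA × P.CoinB) :
      (P.tree ω.1).step (x, ω.2.1) (y, ω.2.2) v = w ↔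
        ((P.tree ω.1).node v = none ∧ v = w) ∨ ∃ p, (P.tree ω.1).node v = some p ∧
          v ++ [(P.tree ω.1).bit p v (x, ω.2.1) (y, ω.2.2)] = w := by
    cases h : (P.tree ω.1).node v with
    | none => simp [step_of_node_eq_none h]
    | some p => simp [step_of_node_eq_some h]
  simp only [step_eq_iff, Set.ofPred_or, Set.ofPred_exists]
  refine ((P.measurableSet_node_eq v none).inter (.const _)).union ?_
  exact .iUnion fun p => (P.measurableSet_node_eq v (some p)).inter
    (P.measurable_bit x y p v (.of_discrete (s := {b | v ++ [b] = w})))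

lemma measurableSet_run_eq (n : ℕ) (v : List Bool) :
    MeasurableSet {ω : P.Pub × P.CoinA × P.CoinB |
      (P.tree ω.1).run (x, ω.2.1) (y, ω.2.2) n = v} := by
  induction n generalizing v with
  | zero => exact .const ([] = v)
  | succ n ih =>
    simp only [run_succ]
    exact measurableSet_ofPred_apply_apply ih fun w => P.measurableSet_step_eq x y w v

lemma measurableSet_phase_eq (v : List Bool) (i : Phase) :
    MeasurableSet {ω : P.Pub × P.CoinA × P.CoinB | (P.tree ω.1).phase v = i} := by
  have phase_two : MeasurableSet {ω : P.Pub × P.CoinA × P.CoinB |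
      ∃ w, w <+: v ∧ w ∈ (P.tree ω.1).marked} := by
    simp only [Set.ofPred_exists]
    exact .iUnion fun w => (MeasurableSet.const _).inter
      (measurable_fst (P.measurableSet_marked w))
  cases i with
  | one => simpa [TwoPhaseTree.phase, Set.compl_ofPred] using phase_two.compl
  | two => simpa [TwoPhaseTree.phase] using phase_two

lemma measurable_bits (p : Player) (i : Phase) :
    Measurable fun ω : P.Pub × P.CoinA × P.CoinB =>
      (P.tree ω.1).bits p i (x, ω.2.1) (y, ω.2.2) := by
  refine Measurable.tsum fun n => Measurable.ite ?_ measurable_const measurable_const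
  exact measurableSet_ofPred_apply_apply (P.measurableSet_run_eq x y n) fun v =>
    (P.measurableSet_node_eq v _).inter (P.measurableSet_phase_eq v i)

end TwoPhaseProtocol

namespace SetInt

open Finset TwoPhaseProtocol

lemma card_filter_entries_eq {α : Type*} [Fintype α] [DecidableEq α] {k : ℕ} {s : Finset α}
    (hs : #s = k) : #{x : Fin k ↪ α | entries x = s} = k.factorial := by
  let inclusion : (Fin k ↪ s) ↪ (Fin k ↪ α) :=
    ⟨fun e => e.trans (.subtype _), fun e e' h => by
      ext i; exact congrArg (fun x : Fin k ↪ α => x i) h⟩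
  have filter_eq : ({x : Fin k ↪ α | entries x = s} : Finset _) = univ.map inclusion := by
    ext x
    simp only [mem_filter_univ, mem_map, mem_univ, true_and]
    constructor
    · rintro rfl
      exact ⟨x.codRestrict _ (apply_mem_entries x), rfl⟩
    · rintro ⟨e, rfl⟩
      refine eq_of_subset_of_card_le (fun a ha => ?_) (by simp [entries, hs])
      obtain ⟨i, -, rfl⟩ := mem_map.1 ha
      exact (e i).2
  rw [filter_eq, card_map, card_univ, Fintype.card_embedding_eq, Fintype.card_coe, hs,
    Fintype.card_fin, Nat.descFactorial_self]

lemma sum_entries {α M : Type*} [Fintype α] [AddCommMonoid M] (k : ℕ)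
    (F : Finset α → M) :
    ∑ x : Fin k ↪ α, F (entries x) =
      k.factorial • ∑ s ∈ powersetCard k (univ : Finset α), F s := by
  classical
  have maps_to : ∀ x ∈ (univ : Finset (Fin k ↪ α)), entries x ∈ powersetCard k (univ : Finset α) :=
    fun x _ => mem_powersetCard.2 ⟨subset_univ _, by simp [entries]⟩
  rw [← sum_fiberwise_of_maps_to' maps_to, smul_sum]
  exact sum_congr rfl fun s hs => by
    rw [sum_const, card_filter_entries_eq (mem_powersetCard.1 hs).2]

section Cost

variable {U k l : ℕ} (hk : k ≤ U) (hl : l ≤ U)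
  (P : TwoPhaseProtocol.{u} (Finset (Fin U)) (Finset (Fin U)) (Finset (Fin U)))
  (p : Player) (i : Phase)

lemma cost_unifSetInt :
    P.cost (unifSetInt U k l hk hl) p i = (U.choose k * U.choose l : ℝ≥0∞)⁻¹ *
      ∑ s ∈ powersetCard k univ, ∑ t ∈ powersetCard l univ, P.costOn p i s t := by
  rw [TwoPhaseProtocol.cost, tsum_fintype, ← sum_product', mul_sum,
    ← sum_subset (subset_univ (powersetCard k univ ×ˢ powersetCard l univ))]
  · refine sum_congr rfl fun z hz => ?_
    rw [unifSetInt, PMF.uniformOfFinset_apply_of_mem _ hz, card_product, Nat.cast_mul,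
      card_powersetCard, card_powersetCard, card_univ, Fintype.card_fin]
  · intro z _ hz
    rw [unifSetInt, PMF.uniformOfFinset_apply_of_notMem _ hz, zero_mul]

lemma sum_costOn_entries :
    ∑ x : Fin k ↪ Fin U, ∑ y : Fin l ↪ Fin U, P.costOn p i (entries x) (entries y) =
      Fintype.card (Fin k ↪ Fin U) * Fintype.card (Fin l ↪ Fin U) *
        P.cost (unifSetInt U k l hk hl) p i := by
  have choose_pos : 0 < U.choose k * U.choose l :=
    Nat.mul_pos (Nat.choose_pos hk) (Nat.choose_pos hl)
  have cancel : (U.choose k * U.choose l : ℝ≥0∞) * (U.choose k * U.choose l : ℝ≥0∞)⁻¹ = 1 :=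
    ENNReal.mul_inv_cancel (by exact_mod_cast choose_pos.ne') (by finiteness)
  rw [cost_unifSetInt, sum_entries k fun s => ∑ y : Fin l ↪ Fin U, P.costOn p i s (entries y)]
  simp only [sum_entries l, nsmul_eq_mul, ← mul_sum, Fintype.card_embedding_eq, Fintype.card_fin,
    Nat.descFactorial_eq_factorial_mul_choose, Nat.cast_mul]
  set S := ∑ s ∈ powersetCard k univ, ∑ t ∈ powersetCard l univ, P.costOn p i s t
  calc
    _ = (k.factorial * l.factorial : ℝ≥0∞) * 1 * S := by ring
    _ = _ := by rw [← cancel]; ring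

lemma lintegral_sum_bits :
    ∫⁻ ω, ∑ x : Fin k ↪ Fin U, ∑ y : Fin l ↪ Fin U,
        (P.tree ω.1).bits p i (entries x, ω.2.1) (entries y, ω.2.2) ∂P.law =
      Fintype.card (Fin k ↪ Fin U) * Fintype.card (Fin l ↪ Fin U) *
        P.cost (unifSetInt U k l hk hl) p i := by
  rw [← sum_costOn_entries, lintegral_finsetSum _ fun x _ => Finset.measurable_fun_sum _ fun y _ =>
    P.measurable_bits _ _ p i]
  exact sum_congr rfl fun x _ => lintegral_finsetSum _ fun y _ => P.measurable_bits _ _ p i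

lemma exists_twoPhaseTree (hP : SolvesSetInt U k l P) {t : Player → Phase → ℝ}
    (ht : ∀ p i, 0 < t p i)
    (hcost : ∀ p i, P.cost (unifSetInt U k l hk hl) p i ≤ ENNReal.ofReal (t p i)) :
    ∃ (T : TwoPhaseTree (Fin k ↪ Fin U) (Fin l ↪ Fin U) (Finset (Fin U))) (N : ℕ),
      (∀ x y, T.outA (T.run x y N) x = entries x ∩ entries y) ∧
      (∀ x y, T.outB (T.run x y N) y = entries x ∩ entries y) ∧
      ∀ p i, T.meanBits p i N ≤ 4 * t p i := by
  have : Nonempty (Fin k ↪ Fin U) := ⟨Fin.castLEEmb hk⟩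
  have : Nonempty (Fin l ↪ Fin U) := ⟨Fin.castLEEmb hl⟩
  have correct : ∀ᵐ ω ∂P.law, ∀ (x : Fin k ↪ Fin U) (y : Fin l ↪ Fin U),
      (P.tree ω.1).BothOutput (entries x, ω.2.1) (entries y, ω.2.2) (entries x ∩ entries y) :=
    ae_all_iff.2 fun x => ae_all_iff.2 fun y =>
      hP (entries x) (entries y) (by simp [entries]) (by simp [entries])
  obtain ⟨ω, correct_at, cheap_at⟩ := exists_forall_le_card_mul (ι := Player × Phase)
    (t := fun a => Fintype.card (Fin k ↪ Fin U) * Fintype.card (Fin l ↪ Fin U) *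
      ENNReal.ofReal (t a.1 a.2))
    (fun a => Finset.measurable_fun_sum _ fun x _ => Finset.measurable_fun_sum _ fun y _ =>
      P.measurable_bits (entries x) (entries y) a.1 a.2)
    (fun a => by simp [ht a.1 a.2, hk, hl]) (fun a => by finiteness)
    (fun a => by rw [lintegral_sum_bits hk hl]; gcongr; exact hcost a.1 a.2) correct
  obtain ⟨N, hA, hB⟩ := TwoPhaseTree.exists_halting_time_comap correct_at
  refine ⟨_, N, hA, hB, fun p i => TwoPhaseTree.meanBits_comap_le
    (mul_nonneg zero_le_four (ht p i).le) ((cheap_at (p, i)).trans_eq ?_) N⟩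
  rw [ENNReal.ofReal_mul zero_le_four, show Fintype.card (Player × Phase) = 4 from rfl]
  norm_num
  ring

end Cost

end SetInt

open SetInt in
theorem lemma1 :
    ∃ ε : ℝ, 0 < ε ∧ ∃ C : ℝ,
      ∀ (U k l : ℕ) (hk : k ≤ U) (hl : l ≤ U),
        1 ≤ k → C * k ≤ l → C * l ≤ U →
        ∀ r : ℝ, 1 < r →
        ∀ P : TwoPhaseProtocol.{u} (Finset (Fin U)) (Finset (Fin U)) (Finset (Fin U)),
          SolvesSetInt U k l P →
          ¬ (P.cost (unifSetInt U k l hk hl) Player.alice Phase.one ≤ ENNReal.ofReal (ε * k) ∧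
             P.cost (unifSetInt U k l hk hl) Player.bob Phase.one ≤ ENNReal.ofReal (ε * l) ∧
             P.cost (unifSetInt U k l hk hl) Player.alice Phase.two
               ≤ ENNReal.ofReal (ε * (k * Real.logb 2 r)) ∧
             P.cost (unifSetInt U k l hk hl) Player.bob Phase.two
               ≤ ENNReal.ofReal (ε * (k / r))) := by
  refine ⟨1 / 200, by norm_num, 100, ?_⟩
  rintro U k l hk hl one_le_k k_le_l l_le_U r one_lt_r P solves
    ⟨alice_one, bob_one, alice_two, bob_two⟩
  have k_le_l : 100 * k ≤ l := by exact_mod_cast k_le_l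
  have l_le_U : 100 * l ≤ U := by exact_mod_cast l_le_U
  obtain ⟨T, N, hA, hB, cheap⟩ := exists_twoPhaseTree hk hl P solves
    (t := fun p i => 1 / 200 * budget k l r p i)
    (fun p i => mul_pos (by norm_num) (budget_pos (by omega) (by omega) one_lt_r p i))
    (by rintro (_ | _) (_ | _) <;> assumption)
  obtain ⟨p, i, expensive⟩ := T.exists_budget_div_lt_meanBits one_le_k (by omega)
    (by rwa [Fintype.card_fin]) hA hB one_lt_r
  linarith [cheap p i]
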